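/- Let $N\ge 0$, $0\le p\le N$, $\alpha>0$ real, and let $\eta=(\eta_1,\dots,\eta_N)$ be a composition (a vector of non-negative integers), $|\eta|=\sum_i\eta_i$. Put $$l'_\eta(i)=\#\{k<i:\eta_k\ge\eta_i\}+\#\{k>i:\eta_k>\eta_i\},\qquad \bar\eta_i=\alpha\eta_i-l'_\eta(i).$$ The non-symmetric Jack polynomial $E_\eta(z)\in\mathbb R[z_1,\dots,z_N]$ is the unique polynomial with $\xi_iE_\eta=\bar\eta_iE_\eta$ for $i=1,\dots,N$ and with coefficient of $z^\eta$ equal to $1$, where $$\xi_i=\alpha z_i\frac{\partial}{\partial z_i}+\sum_{q<i}\frac{z_i}{z_i-z_q}(1-s_{iq})+\sum_{q>i}\frac{z_q}{z_i-z_q}(1-s_{iq})+1-i$$ and $s_{iq}$ exchanges $z_i$ and $z_q$. The coefficients $A^{(p)}_{\eta,\nu}$ are defined by the unique finite expansion $$e_p(z)E_\eta(z)=\sum_\nu A^{(p)}_{\eta,\nu}E_\nu(z),$$ $e_p$ being the $p$-th elementary symmetric polynomial. For compositions $\nu\neq\eta$ with $|\nu|=|\eta|$ write $\nu<\eta$ if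 $\sum_{j\le k}\nu_j\le\sum_{j\le k}\eta_j$ for all $k$; let $\eta^+$ be the decreasing rearrangement of $\eta$, and write $\nu\triangleleft\eta$ if $\nu^+<\eta^+$, or if $\nu^+=\eta^+$ and $\nu<\eta$. For $M\subseteq\{1,\dots,N\}$ let $\chi_M$ be its indicator vector. Let $w_\eta$ be the shortest permutation for which $(\eta_{w_\eta(1)},\dots,\eta_{w_\eta(N)})$ is a partition, and put $\pi_{\nu,\eta}=w_\nu w_\eta^{-1}$. Let $$d'_\eta=\prod_{i=1}^N\prod_{j=1}^{\eta_i}\bigl(\alpha(\eta_i-j+1)+l(i,j)\bigr),\quad l(i,j)=\#\{k<i:j\le\eta_k+1\le\eta_i\}+\#\{k>i:j\le\eta_k\le\eta_i\},$$ $$e'_\eta=\alpha^{|\eta|}\prod_{j=1}^N\frac{\Gamma(1+(N-j)/\alpha+\eta^+_j)}{\Gamma(1+(N-j)/\alpha)},\qquad B^{(p)}_{\eta,\nu}=\frac{d'_\nu\,e'_\eta}{e'_\nu\,d'_\eta}A^{(p)}_{\eta,\nu},$$ $$G_0=\{i:l'_\eta(i)\ge p\},\qquad G_1=\{i:l'_\eta(i)\le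 p-1\}.$$ Then there is exactly one $p$-element set $M^*\subseteq\{1,\dots,N\}$ such that $\eta+\chi_M\triangleleft\eta+\chi_{M^*}$ for every $p$-element set $M\ne M^*$. With $\nu=\eta+\chi_{M^*}$ and $\pi=\pi_{\nu,\eta}$: 1. $A^{(p)}_{\eta,\nu}=1$; 2. $\nu_i=\eta_i+1$ if $l'_\eta(i)\le p-1$, and $\nu_i=\eta_i$ if $l'_\eta(i)\ge p$; 3. $G_0=\{j:\nu_{\pi(j)}=\eta_j\}$ and $G_1=\{j:\nu_{\pi(j)}=\eta_j+1\}$; 4. with all denominators non-zero, $$B^{(p)}_{\eta,\nu}=\Bigl(\prod_{\substack{j\in G_0,\,k\in G_1\\ j<k}}\frac{\bar\eta_j-\bar\eta_k+1}{\bar\eta_j-\bar\eta_k}\Bigr)\Bigl(\prod_{\substack{j\in G_1,\,k\in G_0\\ \pi(j)<\pi(k)}}\frac{\bar\eta_j-\bar\eta_k+\alpha-1}{\bar\eta_j-\bar\eta_k+\alpha}\Bigr).$$ -/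

import Mathlib

namespace NSJack

/-! Compositions with `N` parts are functions `Fin N → ℕ`; the index `i : Fin N` stands for
the part number `i + 1`. -/

/-- `l'_η(i) = #{k < i | η_k ≥ η_i} + #{k > i | η_k > η_i}`. -/
def colegLength {N : ℕ} (η : Fin N → ℕ) (i : Fin N) : ℕ :=
  (Finset.univ.filter fun k => k < i ∧ η i ≤ η k).card +
    (Finset.univ.filter fun k => i < k ∧ η i < η k).card

/-- The eigenvalue `\bar η_i = α η_i - #{k < i | η_k ≥ η_i} - #{k > i | η_k > η_i}`. -/
noncomputable def eigenvalue {N : ℕ} (α : ℝ) (η : Fin N → ℕ) (i : Fin N) : ℝ :=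
  α * (η i : ℝ) - (colegLength η i : ℝ)

/-! ### The non-symmetric Jack polynomials -/

/-- `z_i - z_p` divides `f - s_{ip} f`. -/
theorem sub_dvd_sub_swap {N : ℕ} (i p : Fin N) (f : MvPolynomial (Fin N) ℝ) :
    (MvPolynomial.X i - MvPolynomial.X p : MvPolynomial (Fin N) ℝ) ∣
      f - MvPolynomial.rename (Equiv.swap i p) f := by
  induction f using MvPolynomial.induction_on with
  | C a => simp
  | add f g hf hg =>
    have h := dvd_add hf hg
    rw [map_add]
    convert h using 1
    ring
  | mul_X f j hf =>
    have hX : (MvPolynomial.X i - MvPolynomial.X p : MvPolynomial (Fin N) ℝ) ∣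
        MvPolynomial.X j - MvPolynomial.X (Equiv.swap i p j) := by
      by_cases h1 : j = i
      · subst h1; simp
      · by_cases h2 : j = p
        · subst h2
          rw [Equiv.swap_apply_right]
          exact ⟨-1, by ring⟩
        · rw [Equiv.swap_apply_of_ne_of_ne h1 h2]; simp
    rw [map_mul, MvPolynomial.rename_X]
    have h := dvd_add (Dvd.dvd.mul_right hf (MvPolynomial.X j))
      (Dvd.dvd.mul_left hX (MvPolynomial.rename (Equiv.swap i p) f))
    convert h using 1
    ring

/-- The polynomial `(f - s_{ip} f) / (z_i - z_p)`, where `s_{ip}` exchanges `z_i` and `z_p`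
(used for `i ≠ p`). -/
noncomputable def divDiff {N : ℕ} (i p : Fin N) (f : MvPolynomial (Fin N) ℝ) :
    MvPolynomial (Fin N) ℝ :=
  (sub_dvd_sub_swap i p f).choose

/-- The defining property of the quotient `divDiff`. -/
theorem sub_mul_divDiff {N : ℕ} (i p : Fin N) (f : MvPolynomial (Fin N) ℝ) :
    (MvPolynomial.X i - MvPolynomial.X p) * divDiff i p f =
      f - MvPolynomial.rename (Equiv.swap i p) f :=
  (sub_dvd_sub_swap i p f).choose_spec.symm

/-- The operator
`ξ_i = α z_i ∂/∂z_i + ∑_{p < i} z_i / (z_i - z_p) (1 - s_{ip})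
  + ∑_{p > i} z_p / (z_i - z_p) (1 - s_{ip}) + 1 - i`.
The constant `1 - i` reads `-i` for the zero-based index `i : Fin N`. -/
noncomputable def xi {N : ℕ} (α : ℝ) (i : Fin N) (f : MvPolynomial (Fin N) ℝ) :
    MvPolynomial (Fin N) ℝ :=
  α • (MvPolynomial.X i * MvPolynomial.pderiv i f)
    + (∑ p ∈ Finset.univ.filter (fun p => p < i), MvPolynomial.X i * divDiff i p f)
    + (∑ p ∈ Finset.univ.filter (fun p => i < p), MvPolynomial.X p * divDiff i p f)
    - (i.val : ℝ) • f

/-- `P` is a simultaneous eigenfunction, `ξ_i P = \bar η_i P` for all `i`, in which the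
monomial `z^η` has coefficient one. -/
def IsNonsymmJack {N : ℕ} (α : ℝ) (η : Fin N → ℕ) (P : MvPolynomial (Fin N) ℝ) : Prop :=
  (∀ i, xi α i P = eigenvalue α η i • P) ∧
    MvPolynomial.coeff (Finsupp.equivFunOnFinite.symm η) P = 1

/-- The non-symmetric Jack polynomial `E_η(z)`: the polynomial singled out by
`IsNonsymmJack`. -/
noncomputable def nonsymmJack {N : ℕ} (α : ℝ) (η : Fin N → ℕ) : MvPolynomial (Fin N) ℝ :=
  Classical.epsilon (IsNonsymmJack α η)

/-! ### The Pieri coefficients -/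

/-- `e_p(z) E_η(z) = ∑_ν A_ν E_ν(z)`, a finite sum over compositions `ν`. -/
def IsPieriExpansion {N : ℕ} (α : ℝ) (p : ℕ) (η : Fin N → ℕ) (A : (Fin N → ℕ) →₀ ℝ) : Prop :=
  MvPolynomial.esymm (Fin N) ℝ p * nonsymmJack α η = A.sum fun ν c => c • nonsymmJack α ν

/-- The coefficients `A^{(p)}_{η,ν}` (as a function of `ν`) in the expansion of
`e_p(z) E_η(z)` in non-symmetric Jack polynomials. -/
noncomputable def pieriCoeff {N : ℕ} (α : ℝ) (p : ℕ) (η : Fin N → ℕ) : (Fin N → ℕ) →₀ ℝ :=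
  Classical.epsilon (IsPieriExpansion α p η)

/-! ### Sorting a composition, and the partial order `⊲` -/

/-- `w_η`: the shortest permutation such that `w_η⁻¹(η) = η ∘ w_η` is a partition. It is the
stable sorting permutation; see `antitone_comp_sortPerm` and `sortPerm_shortest`. -/
def sortPerm {N : ℕ} (η : Fin N → ℕ) : Equiv.Perm (Fin N) :=
  Tuple.sort fun i => OrderDual.toDual (η i)

/-- The set of inversions of a permutation; its cardinality is the length. -/
def inversions {N : ℕ} (w : Equiv.Perm (Fin N)) : Finset (Fin N × Fin N) :=
  Finset.univ.filter fun x => x.1 < x.2 ∧ w x.2 < w x.1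

theorem antitone_comp_sortPerm {N : ℕ} (η : Fin N → ℕ) : Antitone (η ∘ sortPerm η) :=
  fun i j hij => Tuple.monotone_sort (fun i => OrderDual.toDual (η i)) hij

theorem sortPerm_shortest {N : ℕ} (η : Fin N → ℕ) (w : Equiv.Perm (Fin N))
    (hw : Antitone (η ∘ w)) (hne : w ≠ sortPerm η) :
    (inversions (sortPerm η)).card < (inversions w).card := by
  have hstable : ∀ i j, i < j → η (sortPerm η i) = η (sortPerm η j) →
      sortPerm η i < sortPerm η j :=
    ((Tuple.eq_sort_iff (f := fun i => OrderDual.toDual (η i)) (σ := sortPerm η)).1 rfl).2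
  have hex : ∃ i j, i < j ∧ η (w i) = η (w j) ∧ w j < w i := by
    by_contra hcon
    push Not at hcon
    refine hne ((Tuple.eq_sort_iff (f := fun i => OrderDual.toDual (η i))).2 ⟨hw, ?_⟩)
    intro i j hij he
    exact lt_of_le_of_ne (hcon i j hij he) fun h => hij.ne (w.injective h)
  obtain ⟨i₀, j₀, hij₀, he₀, hinv₀⟩ := hex
  let g : Fin N × Fin N → Fin N × Fin N :=
    fun x => (w.symm (sortPerm η x.1), w.symm (sortPerm η x.2))
  have hg : Function.Injective g := by
    intro x y hxy
    simp only [g, Prod.mk.injEq, EmbeddingLike.apply_eq_iff_eq] at hxy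
    exact Prod.ext hxy.1 hxy.2
  have hlt : ∀ x ∈ inversions (sortPerm η), η (sortPerm η x.2) < η (sortPerm η x.1) := by
    intro x hx
    simp only [inversions, Finset.mem_filter, Finset.mem_univ, true_and] at hx
    refine lt_of_le_of_ne (antitone_comp_sortPerm η hx.1.le) fun h => ?_
    exact absurd (hstable _ _ hx.1 h.symm) (not_lt.2 hx.2.le)
  rw [← Finset.card_image_of_injective _ hg]
  refine Finset.card_lt_card (Finset.ssubset_iff_subset_ne.2 ⟨?_, ?_⟩)
  · intro y hy
    obtain ⟨x, hx, rfl⟩ := Finset.mem_image.1 hy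
    have h1 := hlt x hx
    simp only [inversions, Finset.mem_filter, Finset.mem_univ, true_and] at hx
    simp only [inversions, g, Finset.mem_filter, Finset.mem_univ, true_and,
      Equiv.apply_symm_apply]
    refine ⟨?_, hx.2⟩
    by_contra hcon
    have h2 := hw (not_lt.1 hcon)
    simp only [Function.comp_apply, Equiv.apply_symm_apply] at h2
    omega
  · intro heq
    have hmem : (i₀, j₀) ∈ inversions w := by
      simp [inversions, hij₀, hinv₀]
    rw [← heq] at hmem
    obtain ⟨x, hx, hxe⟩ := Finset.mem_image.1 hmem
    have h1 := hlt x hx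
    simp only [g, Prod.mk.injEq, Equiv.symm_apply_eq] at hxe
    rw [hxe.1, hxe.2] at h1
    omega

/-- The partition `η⁺` obtained by rearranging the parts of `η` in decreasing order. -/
def toPartition {N : ℕ} (η : Fin N → ℕ) : Fin N → ℕ :=
  η ∘ sortPerm η

/-- The (strict) dominance order on compositions of the same modulus. -/
def DomLT {N : ℕ} (ν η : Fin N → ℕ) : Prop :=
  ∑ j, ν j = ∑ j, η j ∧ ν ≠ η ∧
    ∀ k : Fin N, ∑ j ∈ Finset.Iic k, ν j ≤ ∑ j ∈ Finset.Iic k, η j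

/-- `ν ⊲ η`. -/
def TriLT {N : ℕ} (ν η : Fin N → ℕ) : Prop :=
  DomLT (toPartition ν) (toPartition η) ∨ (toPartition ν = toPartition η ∧ DomLT ν η)

/-- `η + χ_M`: one box is added to each of the rows in `M`. -/
def addBoxes {N : ℕ} (η : Fin N → ℕ) (M : Finset (Fin N)) : Fin N → ℕ :=
  fun i => η i + if i ∈ M then 1 else 0

/-- `M` is the `p`-element set `M*` for which `η + χ_M` is `⊲`-above `η + χ_{M'}` for every
other `p`-element set `M'`. -/
def IsTopSet {N : ℕ} (p : ℕ) (η : Fin N → ℕ) (M : Finset (Fin N)) : Prop :=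
  M.card = p ∧ ∀ M' : Finset (Fin N), M'.card = p → M' ≠ M →
    TriLT (addBoxes η M') (addBoxes η M)

/-- `π_{ν,η} = w_ν ∘ w_η⁻¹`. -/
def rowPerm {N : ℕ} (ν η : Fin N → ℕ) : Equiv.Perm (Fin N) :=
  sortPerm ν * (sortPerm η)⁻¹

/-- `G_0 = {i | l'_η(i) ≥ p}`. -/
def G0 {N : ℕ} (p : ℕ) (η : Fin N → ℕ) : Finset (Fin N) :=
  Finset.univ.filter fun i => p ≤ colegLength η i

/-- `G_1 = {i | l'_η(i) ≤ p - 1}`. -/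
def G1 {N : ℕ} (p : ℕ) (η : Fin N → ℕ) : Finset (Fin N) :=
  Finset.univ.filter fun i => colegLength η i < p

/-! ### The normalization -/

/-- The leg length `l(i,j)` of the node in row `i` and column `j` (columns start at 1). -/
def leg {N : ℕ} (η : Fin N → ℕ) (i : Fin N) (j : ℕ) : ℕ :=
  (Finset.univ.filter fun k => k < i ∧ j ≤ η k + 1 ∧ η k + 1 ≤ η i).card +
    (Finset.univ.filter fun k => i < k ∧ j ≤ η k ∧ η k ≤ η i).card

/-- `d'_η = ∏_{(i,j) ∈ η} (α (a(i,j) + 1) + l(i,j))`, with arm length `a(i,j) = η_i - j`. -/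
noncomputable def dPrime {N : ℕ} (α : ℝ) (η : Fin N → ℕ) : ℝ :=
  ∏ i : Fin N, ∏ j ∈ Finset.Icc 1 (η i),
    (α * (((η i : ℝ) - (j : ℝ)) + 1) + (leg η i j : ℝ))

/-- The generalized factorial
`[u]_{η⁺}^{(α)} = ∏_{j=1}^N Γ(u - (j-1)/α + η⁺_j) / Γ(u - (j-1)/α)`. -/
noncomputable def genFactorial {N : ℕ} (α u : ℝ) (η : Fin N → ℕ) : ℝ :=
  ∏ j : Fin N, Real.Gamma (u - (j.val : ℝ) / α + (toPartition η j : ℝ)) /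
    Real.Gamma (u - (j.val : ℝ) / α)

/-- `e'_η = α^{|η|} [1 + (N-1)/α]_{η⁺}^{(α)}`. -/
noncomputable def ePrime {N : ℕ} (α : ℝ) (η : Fin N → ℕ) : ℝ :=
  α ^ (∑ i, η i) * genFactorial α (1 + ((N : ℝ) - 1) / α) η

/-- `B^{(p)}_{η,ν} = (d'_ν e'_η) / (e'_ν d'_η) A^{(p)}_{η,ν}`. -/
noncomputable def normPieriCoeff {N : ℕ} (α : ℝ) (p : ℕ) (η ν : Fin N → ℕ) : ℝ :=
  dPrime α ν * ePrime α η / (ePrime α ν * dPrime α η) * pieriCoeff α p η ν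

end NSJack

/-! Sort the rows of `η` stably in decreasing order; then `l'_η(i)` is the zero-based position of
row `i`, and `G1` consists of the first `p` rows. Adding a box to an initial segment does not change
the sorted order, so `w_ν = w_η`, `π` is the identity, and items 2 and 3 are immediate. That this
choice is the top one is a greedy argument: dominance of partitions is pointwise comparison of
`excess`, and filling `G1` attains the upper bound for the new excess in every column
(`excess_topBoxes_succ`). Other choices with the same partition move boxes downwards.

For the coefficient, order compositions by `key`, dominance with lexicographic tie-breaking. The
`ξ_i` are triangular on monomials (`xi_mono_sub_mem`) and their diagonal entries separate
compositions (`eigenvalue_injective`), so a joint eigenfunction is determined by its leading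
coefficient. Existence follows from adjacent transpositions and the raising operator. In `e_p E_η`
the monomial `z^ν` arises only as `z^{χ_{G1}} z^η`, and no exponent lies above `ν`; hence `A = 1`
(`pieriCoeff_topBoxes`).

For the product formula, each row of `d'_η` becomes a product of Gamma functions. Up to a constant
depending only on `N` and `α`, `d'_η / e'_η` is a product over pairs, `i` before `k` in sorted
order, of `Γ(x - 1/α) / Γ(x)`, where `x = (η̄_i - η̄_k)/α + [i < k]` (`dPrime_eq`). Passing to `ν`
raises `x` by one exactly when `i ∈ G1` and `k ∈ G0`, so `Γ(x + 1) = x Γ(x)` leaves one factor `(x -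
1/α)/x` for each such pair. -/

namespace NSJack

variable {N : ℕ}

/-! ### Combinatorics of compositions: sorted order, dominance, eigenvalues. -/

section

open Finset

/-! ### The order in which the rows of a composition are sorted -/

/-- Row `k` comes before row `i` when the rows of `η` are sorted stably in decreasing order. -/
def Precedes (η : Fin N → ℕ) (k i : Fin N) : Prop :=
  η i < η k ∨ (η i = η k ∧ k < i)

instance (η : Fin N → ℕ) (k i : Fin N) : Decidable (Precedes η k i) :=
  inferInstanceAs (Decidable (_ ∨ _))

theorem Precedes.trans {η : Fin N → ℕ} {i j k : Fin N} (h₁ : Precedes η i j)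
    (h₂ : Precedes η j k) : Precedes η i k := by
  unfold Precedes at *; omega

theorem not_precedes_self (η : Fin N → ℕ) (i : Fin N) : ¬ Precedes η i i := by
  unfold Precedes; omega

theorem precedes_or_precedes (η : Fin N → ℕ) {i k : Fin N} (h : i ≠ k) :
    Precedes η i k ∨ Precedes η k i := by
  unfold Precedes; omega

theorem colegLength_eq_card (η : Fin N → ℕ) (i : Fin N) :
    colegLength η i = (univ.filter fun k => Precedes η k i).card := by
  rw [colegLength, ← card_union_of_disjoint]
  · congr 1
    ext k
    simp only [mem_union, mem_filter, mem_univ, true_and]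
    unfold Precedes
    rcases eq_or_ne k i with rfl | h <;> omega
  · rw [disjoint_filter]
    intro k _ h₁ h₂
    exact absurd h₁.1 (not_lt.2 h₂.1.le)

/-- By transitivity the predecessors of `k` are predecessors of `i`, and `k` itself is an additional
one. -/
theorem Precedes.colegLength_lt {η : Fin N → ℕ} {k i : Fin N} (h : Precedes η k i) :
    colegLength η k < colegLength η i := by
  rw [colegLength_eq_card, colegLength_eq_card]
  refine card_lt_card (ssubset_iff_of_subset ?_ |>.2 ⟨k, by simpa using h, ?_⟩)
  · intro j hj
    simp only [mem_filter, mem_univ, true_and] at hj ⊢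
    exact hj.trans h
  · simpa using not_precedes_self η k

theorem colegLength_lt_iff {η : Fin N → ℕ} {k i : Fin N} :
    colegLength η k < colegLength η i ↔ Precedes η k i := by
  refine ⟨fun h => ?_, Precedes.colegLength_lt⟩
  rcases precedes_or_precedes η (show k ≠ i by rintro rfl; exact lt_irrefl _ h) with h' | h'
  · exact h'
  · exact absurd h'.colegLength_lt h.le.not_gt

theorem colegLength_injective (η : Fin N → ℕ) : Function.Injective (colegLength η) := by
  intro i k h
  by_contra hne
  rcases precedes_or_precedes η hne with h' | h' <;> have := h'.colegLength_lt <;> omega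

theorem precedes_sortPerm_iff (η : Fin N → ℕ) {r s : Fin N} :
    Precedes η (sortPerm η r) (sortPerm η s) ↔ r < s := by
  have key : ∀ r s, r < s → Precedes η (sortPerm η r) (sortPerm η s) := by
    intro r s h
    have h₁ : η (sortPerm η s) ≤ η (sortPerm η r) := antitone_comp_sortPerm η h.le
    have h₂ := ((Tuple.eq_sort_iff (f := fun i => OrderDual.toDual (η i))
      (σ := sortPerm η)).1 rfl).2 r s h
    rcases h₁.lt_or_eq with h₃ | h₃
    · exact Or.inl h₃
    · exact Or.inr ⟨h₃, h₂ h₃.symm⟩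
  refine ⟨fun h => ?_, key r s⟩
  rcases lt_trichotomy r s with h' | rfl | h'
  · exact h'
  · exact absurd h (not_precedes_self _ _)
  · exact absurd (h.trans (key _ _ h')) (not_precedes_self _ _)

theorem colegLength_sortPerm (η : Fin N → ℕ) (r : Fin N) :
    colegLength η (sortPerm η r) = r := by
  have : (univ.filter fun k => Precedes η k (sortPerm η r)) =
      (Iio r).map (sortPerm η).toEmbedding := by
    ext k
    obtain ⟨s, rfl⟩ := (sortPerm η).surjective k
    simp [precedes_sortPerm_iff]
  rw [colegLength_eq_card, this, card_map, Fin.card_Iio]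

theorem sortPerm_eq_of_colegLength_eq {η ν : Fin N → ℕ}
    (h : ∀ i, colegLength η i = colegLength ν i) : sortPerm η = sortPerm ν := by
  ext1 r
  apply colegLength_injective η
  rw [colegLength_sortPerm, h, colegLength_sortPerm]

theorem mem_G1 {p : ℕ} {η : Fin N → ℕ} {i : Fin N} : i ∈ G1 p η ↔ colegLength η i < p := by
  simp [G1]

theorem mem_G0 {p : ℕ} {η : Fin N → ℕ} {i : Fin N} : i ∈ G0 p η ↔ p ≤ colegLength η i := by
  simp [G0]

theorem card_G1 {p : ℕ} (hp : p ≤ N) (η : Fin N → ℕ) : (G1 p η).card = p := by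
  have : G1 p η = (univ.filter fun r : Fin N => (r : ℕ) < p).map (sortPerm η).toEmbedding := by
    ext k
    obtain ⟨s, rfl⟩ := (sortPerm η).surjective k
    simp [mem_G1, colegLength_sortPerm]
  rw [this, card_map, Fin.card_filter_val_lt]
  omega

/-! ### Adding boxes to the longest rows -/

/-- One box is added to each of the first `p` rows in sorted order. -/
abbrev topBoxes (p : ℕ) (η : Fin N → ℕ) : Fin N → ℕ := addBoxes η (G1 p η)

theorem topBoxes_apply (p : ℕ) (η : Fin N → ℕ) (i : Fin N) :
    topBoxes p η i = if colegLength η i < p then η i + 1 else η i := by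
  simp only [addBoxes, mem_G1]
  split_ifs <;> rfl

/-- The boxes go to an initial segment of the sorted order, so a row receives one whenever a later
row does. -/
theorem Precedes.topBoxes {p : ℕ} {η : Fin N → ℕ} {k i : Fin N} (h : Precedes η k i) :
    Precedes (topBoxes p η) k i := by
  have := h.colegLength_lt
  unfold Precedes at *
  rw [topBoxes_apply, topBoxes_apply]
  split_ifs <;> omega

theorem precedes_topBoxes_iff {p : ℕ} {η : Fin N → ℕ} {k i : Fin N} :
    Precedes (NSJack.topBoxes p η) k i ↔ Precedes η k i := by
  refine ⟨fun h => ?_, Precedes.topBoxes⟩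
  have hne : k ≠ i := by rintro rfl; exact not_precedes_self _ _ h
  rcases precedes_or_precedes η hne with h' | h'
  · exact h'
  · exact absurd (h.trans h'.topBoxes) (not_precedes_self _ _)

theorem colegLength_topBoxes (p : ℕ) (η : Fin N → ℕ) (i : Fin N) :
    colegLength (topBoxes p η) i = colegLength η i := by
  simp only [colegLength_eq_card, precedes_topBoxes_iff]

theorem sortPerm_topBoxes (p : ℕ) (η : Fin N → ℕ) : sortPerm (topBoxes p η) = sortPerm η :=
  sortPerm_eq_of_colegLength_eq (colegLength_topBoxes p η)

theorem rowPerm_topBoxes (p : ℕ) (η : Fin N → ℕ) : rowPerm (topBoxes p η) η = 1 := by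
  rw [rowPerm, sortPerm_topBoxes, mul_inv_cancel]

/-! ### The excess function -/

/-- The number of boxes of `η` beyond column `t`. Pointwise comparison of this function is the
dominance order of the associated partitions. -/
def excess (η : Fin N → ℕ) (t : ℕ) : ℕ := ∑ i, (η i - t)

theorem excess_zero (η : Fin N → ℕ) : excess η 0 = ∑ i, η i := by simp [excess]

theorem excess_comp_perm (η : Fin N → ℕ) (w : Equiv.Perm (Fin N)) :
    excess (η ∘ w) = excess η := by
  funext t
  exact Equiv.sum_comp w fun i => η i - t

theorem excess_eq_succ_add (η : Fin N → ℕ) (t : ℕ) :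
    excess η t = excess η (t + 1) + (univ.filter fun i => t < η i).card := by
  rw [excess, excess, card_filter, ← sum_add_distrib]
  refine sum_congr rfl fun i _ => ?_
  split_ifs <;> omega

theorem excess_addBoxes_zero (η : Fin N → ℕ) (M : Finset (Fin N)) :
    excess (addBoxes η M) 0 = excess η 0 + M.card := by
  simp [excess_zero, addBoxes, sum_add_distrib]

theorem excess_addBoxes_succ (η : Fin N → ℕ) (M : Finset (Fin N)) (t : ℕ) :
    excess (addBoxes η M) (t + 1) = excess η (t + 1) + (M.filter fun i => t < η i).card := by
  rw [← Finset.univ_inter M, ← Finset.filter_mem_eq_inter, filter_filter, card_filter, excess,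
    excess, ← sum_add_distrib]
  refine sum_congr rfl fun i _ => ?_
  simp only [addBoxes]
  by_cases hi : i ∈ M <;> by_cases ht : t < η i <;> simp [hi, ht] <;> omega

/-- A new box counts beyond column `t + 1` only in a row longer than `t`; the number of such boxes
is bounded both by `M.card` and by the number of such rows. -/
theorem excess_addBoxes_succ_le (η : Fin N → ℕ) (M : Finset (Fin N)) (t : ℕ) :
    excess (addBoxes η M) (t + 1) ≤ min (excess η (t + 1) + M.card) (excess η t) := by
  rw [excess_addBoxes_succ, excess_eq_succ_add η t]
  refine le_min (Nat.add_le_add_left (card_filter_le _ _) _) (Nat.add_le_add_left ?_ _)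
  exact card_le_card (filter_subset_filter _ (subset_univ _))

/-- The rows longer than `t` and the set `G1` are both initial segments of the sorted order, so one
contains the other, and one of the two bounds is attained. -/
theorem excess_topBoxes_succ {p : ℕ} (hp : p ≤ N) (η : Fin N → ℕ) (t : ℕ) :
    excess (topBoxes p η) (t + 1) = min (excess η (t + 1) + p) (excess η t) := by
  refine le_antisymm (by simpa [card_G1 hp] using excess_addBoxes_succ_le η (G1 p η) t) ?_
  rw [excess_addBoxes_succ, excess_eq_succ_add η t, min_le_iff]
  by_cases hcase : (univ.filter fun i => t < η i).card ≤ p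
  · right
    refine Nat.add_le_add_left (card_le_card fun i hi => ?_) _
    simp only [mem_filter, mem_univ, true_and, mem_G1] at hi ⊢
    refine ⟨lt_of_lt_of_le ?_ hcase, hi⟩
    rw [colegLength_eq_card]
    refine card_lt_card (ssubset_iff_of_subset ?_ |>.2 ⟨i, by simpa using hi, ?_⟩)
    · intro k hk
      simp only [mem_filter, mem_univ, true_and] at hk ⊢
      unfold Precedes at *
      omega
    · simpa using not_precedes_self η i
  · left
    rw [filter_true_of_mem, card_G1 hp]
    intro i hi
    rw [mem_G1, colegLength_eq_card] at hi
    by_contra hti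
    have : (univ.filter fun k => t < η k).card ≤ (univ.filter fun k => Precedes η k i).card := by
      refine card_le_card fun k hk => ?_
      simp only [mem_filter, mem_univ, true_and] at hk ⊢
      unfold Precedes at *
      omega
    omega

theorem excess_addBoxes_le_topBoxes {p : ℕ} (hp : p ≤ N) {μ η : Fin N → ℕ}
    (h : excess μ ≤ excess η) {M : Finset (Fin N)} (hM : M.card = p) :
    excess (addBoxes μ M) ≤ excess (topBoxes p η) := by
  intro t
  cases t with
  | zero =>
    rw [excess_addBoxes_zero, excess_addBoxes_zero, card_G1 hp, hM]
    exact Nat.add_le_add_right (h 0) _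
  | succ t =>
    rw [excess_topBoxes_succ hp]
    refine (excess_addBoxes_succ_le _ _ _).trans ?_
    rw [hM]
    exact min_le_min (Nat.add_le_add_right (h _) _) (h _)

/-- The rigidity behind strict monotonicity: a strict gap in dominance cannot be closed by adding
`p` boxes to both sides. -/
theorem excess_eq_of_addBoxes_eq_topBoxes {p : ℕ} (hp : p ≤ N) {μ η : Fin N → ℕ}
    (h : excess μ ≤ excess η) {M : Finset (Fin N)} (hM : M.card = p)
    (he : excess (addBoxes μ M) = excess (topBoxes p η)) : excess μ = excess η := by
  refine le_antisymm h fun t => ?_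
  cases t with
  | zero =>
    change excess η 0 ≤ excess μ 0
    have := congrFun he 0
    rw [excess_addBoxes_zero, excess_addBoxes_zero, card_G1 hp, hM] at this
    omega
  | succ t =>
    change excess η (t + 1) ≤ excess μ (t + 1)
    -- If more than `p` rows of `η` exceed `t`, the bound at `t` gives the claim; otherwise at most
    -- `p` rows exceed `t + 1`, and the bound at `t + 1` does.
    have h₁ := excess_addBoxes_succ_le μ M t
    have h₂ := excess_addBoxes_succ_le μ M (t + 1)
    rw [he, excess_topBoxes_succ hp, hM] at h₁ h₂
    have h₃ := excess_eq_succ_add η t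
    have h₄ := excess_eq_succ_add η (t + 1)
    have h₅ : (univ.filter fun i => t + 1 < η i).card ≤ (univ.filter fun i => t < η i).card :=
      card_le_card fun i hi => by
        simp only [mem_filter, mem_univ, true_and] at hi ⊢
        omega
    omega

theorem card_filter_lt_eq_of_excess_eq {μ η : Fin N → ℕ} (h : excess μ = excess η) (t : ℕ) :
    (univ.filter fun i => t < μ i).card = (univ.filter fun i => t < η i).card := by
  have h₁ := excess_eq_succ_add μ t
  have h₂ := excess_eq_succ_add η t
  rw [h] at h₁
  omega

/-- If `η + χ_M` has the same partition as `η + χ_{G_1}`, then `M` is obtained from `G_1` by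
moving boxes downwards. -/
theorem lt_of_excess_addBoxes_eq {p : ℕ} (hp : p ≤ N) {η : Fin N → ℕ} {M : Finset (Fin N)}
    (hM : M.card = p) (he : excess (addBoxes η M) = excess (topBoxes p η)) {i j : Fin N}
    (hi : i ∈ M) (hi' : i ∉ G1 p η) (hj : j ∈ G1 p η) (hj' : j ∉ M) : j < i := by
  have hji : Precedes η j i := by
    rw [mem_G1] at hi' hj
    exact colegLength_lt_iff.1 (by omega)
  rcases hji with hlt | h
  · exfalso
    -- At this column both bounds in the minimum are strict: the box in row `i` does not count, and
    -- the longer row `j` gets none.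
    have h₁ := congrFun he (η i + 1)
    rw [excess_topBoxes_succ hp, excess_addBoxes_succ, excess_eq_succ_add η (η i)] at h₁
    have h₂ : (M.filter fun k => η i < η k).card < p := by
      rw [← hM]
      exact card_lt_card (filter_ssubset.2 ⟨i, hi, lt_irrefl _⟩)
    have h₃ : (M.filter fun k => η i < η k).card < (univ.filter fun k => η i < η k).card := by
      refine card_lt_card (ssubset_iff_of_subset (filter_subset_filter _ (subset_univ _)) |>.2
        ⟨j, by simpa using hlt, by simp [hj']⟩)
    omega
  · exact h.2

/-! ### The order `⊲` -/

/-- Together with the next lemma this is a duality: the partial sums of a partition are minima over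
`t` of `(k + 1) t + excess t`, attained at `t = f k`. It turns comparison of excess into dominance.
-/
theorem sum_Iic_le (f : Fin N → ℕ) (k : Fin N) (t : ℕ) :
    ∑ j ∈ Iic k, f j ≤ (k + 1) * t + excess f t := by
  calc ∑ j ∈ Iic k, f j ≤ ∑ j ∈ Iic k, (t + (f j - t)) := sum_le_sum fun j _ => by omega
    _ = (k + 1) * t + ∑ j ∈ Iic k, (f j - t) := by
      rw [sum_add_distrib, sum_const, Fin.card_Iic, smul_eq_mul]
    _ ≤ _ := Nat.add_le_add_left (sum_le_sum_of_subset (subset_univ _)) _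

theorem Antitone.sum_Iic_eq {f : Fin N → ℕ} (hf : Antitone f) (k : Fin N) :
    ∑ j ∈ Iic k, f j = (k + 1) * f k + excess f (f k) := by
  have h₁ : excess f (f k) = ∑ j ∈ Iic k, (f j - f k) := by
    refine (sum_subset (subset_univ _) fun j _ hj => ?_).symm
    have := hf (not_le.1 (fun h => hj (mem_Iic.2 h))).le
    omega
  rw [h₁, ← Fin.card_Iic k, ← smul_eq_mul, ← sum_const, ← sum_add_distrib]
  refine sum_congr rfl fun j hj => ?_
  have := hf (mem_Iic.1 hj)
  omega

theorem excess_toPartition (η : Fin N → ℕ) : excess (toPartition η) = excess η :=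
  excess_comp_perm η _

theorem domLT_toPartition_of_excess_le {μ η : Fin N → ℕ} (h₀ : ∑ i, μ i = ∑ i, η i)
    (h : excess μ ≤ excess η) (hne : toPartition μ ≠ toPartition η) :
    DomLT (toPartition μ) (toPartition η) := by
  refine ⟨?_, hne, fun k => ?_⟩
  · rw [← excess_zero, ← excess_zero, excess_toPartition, excess_toPartition, excess_zero,
      excess_zero, h₀]
  · rw [Antitone.sum_Iic_eq (f := toPartition η) (antitone_comp_sortPerm η) k]
    refine (sum_Iic_le _ k (toPartition η k)).trans (Nat.add_le_add_left ?_ _)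
    rw [excess_toPartition]
    exact (h _).trans (by rw [← excess_toPartition η])

theorem addBoxes_injective (η : Fin N → ℕ) : Function.Injective (addBoxes η) := by
  intro M M' h
  ext i
  have := congrFun h i
  simp only [addBoxes] at this
  split_ifs at this with h₁ h₂ h₂ <;> simp_all

theorem isTopSet_G1 {p : ℕ} (hp : p ≤ N) (η : Fin N → ℕ) : IsTopSet p η (G1 p η) := by
  refine ⟨card_G1 hp η, fun M hM hne => ?_⟩
  have hsum : ∑ i, addBoxes η M i = ∑ i, topBoxes p η i := by
    rw [← excess_zero, ← excess_zero, excess_addBoxes_zero, excess_addBoxes_zero, hM, card_G1 hp]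
  by_cases heq : toPartition (addBoxes η M) = toPartition (topBoxes p η)
  · refine Or.inr ⟨heq, hsum, fun h => hne (addBoxes_injective η h), fun k => ?_⟩
    have he : excess (addBoxes η M) = excess (topBoxes p η) := by
      rw [← excess_toPartition, heq, excess_toPartition]
    simp only [addBoxes, sum_add_distrib, ← card_filter]
    refine Nat.add_le_add_left ?_ _
    have hcard : ∀ A B : Finset (Fin N), ((Iic k).filter (· ∈ A)).card =
        ((A \ B) ∩ Iic k).card + ((A ∩ B) ∩ Iic k).card := by
      intro A B
      rw [← card_union_of_disjoint, ← union_inter_distrib_right, sdiff_union_inter,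
        filter_mem_eq_inter, inter_comm]
      exact (disjoint_sdiff_inter A B).mono inter_subset_left inter_subset_left
    rw [hcard M (G1 p η), hcard (G1 p η) M, inter_comm (G1 p η) M]
    refine Nat.add_le_add_right ?_ _
    -- Once a displaced box of `M` lies within the first `k` rows, all rows of `G1 \ M` lie above
    -- it; the two differences have equal size.
    rcases ((M \ G1 p η) ∩ Iic k).eq_empty_or_nonempty with h0 | ⟨i, hi⟩
    · simp [h0]
    · simp only [mem_inter, mem_sdiff, mem_Iic] at hi
      have hsub : G1 p η \ M ⊆ Iic k := by
        intro j hj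
        rw [mem_sdiff] at hj
        exact mem_Iic.2
          ((lt_of_excess_addBoxes_eq hp hM he hi.1.1 hi.1.2 hj.1 hj.2).le.trans hi.2)
      rw [inter_eq_left.2 hsub]
      refine (card_le_card inter_subset_left).trans (le_of_eq ?_)
      exact card_sdiff_comm (by rw [hM, card_G1 hp])
  · exact Or.inl (domLT_toPartition_of_excess_le hsum
      (excess_addBoxes_le_topBoxes hp le_rfl hM) heq)

theorem DomLT.asymm {μ η : Fin N → ℕ} (h : DomLT μ η) : ¬ DomLT η μ := by
  intro h'
  refine h.2.1 ?_
  funext k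
  induction k using WellFoundedLT.induction with
  | ind k ih =>
    have hk := le_antisymm (h.2.2 k) (h'.2.2 k)
    rw [← Iio_insert, sum_insert (by simp), sum_insert (by simp),
      sum_congr rfl fun j hj => ih j (mem_Iio.1 hj)] at hk
    exact Nat.add_right_cancel hk

theorem TriLT.asymm {μ η : Fin N → ℕ} (h : TriLT μ η) : ¬ TriLT η μ := by
  rintro (h' | ⟨h₁, h₂⟩) <;> rcases h with h | ⟨h₃, h₄⟩
  · exact h.asymm h'
  · exact h'.2.1 h₃.symm
  · exact h.2.1 h₁.symm
  · exact h₄.asymm h₂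

theorem isTopSet_iff {p : ℕ} (hp : p ≤ N) (η : Fin N → ℕ) (M : Finset (Fin N)) :
    IsTopSet p η M ↔ M = G1 p η := by
  refine ⟨fun h => ?_, fun h => h ▸ isTopSet_G1 hp η⟩
  by_contra hne
  exact (h.2 _ (card_G1 hp η) (Ne.symm hne)).asymm ((isTopSet_G1 hp η).2 M h.1 hne)

/-! ### A partial order for which the operators `ξ_i` are triangular -/

/-- Compositions are compared by the dominance order of their partitions, and then
lexicographically. -/
def key (η : Fin N → ℕ) : (ℕ → ℕ) ×ₗ Lex (Fin N → ℕ) := toLex (excess η, toLex η)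

theorem key_injective : Function.Injective (key (N := N)) := fun _ _ h =>
  toLex.injective (Prod.ext_iff.1 (toLex.injective h)).2

theorem key_lt_iff {μ η : Fin N → ℕ} :
    key μ < key η ↔ excess μ < excess η ∨ (excess μ = excess η ∧ toLex μ < toLex η) :=
  Prod.Lex.toLex_lt_toLex

theorem key_le_iff {μ η : Fin N → ℕ} :
    key μ ≤ key η ↔ excess μ < excess η ∨ (excess μ = excess η ∧ toLex μ ≤ toLex η) :=
  Prod.Lex.toLex_le_toLex

theorem excess_le_of_key_le {μ η : Fin N → ℕ} (h : key μ ≤ key η) : excess μ ≤ excess η := by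
  rcases key_le_iff.1 h with h | h
  exacts [h.le, h.1.le]

theorem key_lt_of_excess_le {μ η : Fin N → ℕ} (h : excess μ ≤ excess η)
    (hlex : excess μ = excess η → toLex μ < toLex η) : key μ < key η := by
  rcases h.lt_or_eq with h | h
  exacts [key_lt_iff.2 (Or.inl h), key_lt_iff.2 (Or.inr ⟨h, hlex h⟩)]

/-- The excess at `0` is the modulus, so every part is bounded by `|η|`. This makes induction along
`key` possible although `key` is only partially ordered. -/
theorem finite_key_lt (η : Fin N → ℕ) : {μ : Fin N → ℕ | key μ < key η}.Finite := by
  refine (Set.finite_Iic fun _ : Fin N => ∑ i, η i).subset fun μ hμ i => ?_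
  have := excess_le_of_key_le (le_of_lt hμ) 0
  rw [excess_zero, excess_zero] at this
  exact (single_le_sum (fun _ _ => Nat.zero_le _) (mem_univ i)).trans this

theorem key_induction {P : (Fin N → ℕ) → Prop}
    (h : ∀ η, (∀ μ, key μ < key η → P μ) → P η) (η : Fin N → ℕ) : P η := by
  induction hn : {μ : Fin N → ℕ | key μ < key η}.ncard using Nat.strong_induction_on
    generalizing η with
  | _ n ih =>
    subst hn
    refine h η fun μ hμ => ih _ (Set.ncard_lt_ncard ⟨fun κ hκ => lt_trans hκ hμ, ?_⟩
      (finite_key_lt η)) μ rfl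
    exact fun hsub => lt_irrefl (key μ) (hsub hμ)

theorem key_addBoxes_lt_topBoxes {p : ℕ} (hp : p ≤ N) {η : Fin N → ℕ} {M : Finset (Fin N)}
    (hM : M.card = p) (hne : M ≠ G1 p η) : key (addBoxes η M) < key (topBoxes p η) := by
  refine key_lt_of_excess_le (excess_addBoxes_le_topBoxes hp le_rfl hM) fun he => ?_
  have hcard : (G1 p η \ M).card = (M \ G1 p η).card :=
    card_sdiff_comm (by rw [hM, card_G1 hp])
  have hnon : (G1 p η \ M).Nonempty := by
    rw [nonempty_iff_ne_empty]
    intro h0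
    rw [h0, card_empty, eq_comm, card_eq_zero, sdiff_eq_empty_iff_subset] at hcard
    exact hne (hcard.antisymm (sdiff_eq_empty_iff_subset.1 h0))
  have hj := min'_mem _ hnon
  -- The first row where the two choices differ: any row of `M \ G1` comes after every row of `G1 \
  -- M`.
  set j := (G1 p η \ M).min' hnon with hjdef
  rw [mem_sdiff] at hj
  refine ⟨j, fun i hi => ?_, ?_⟩
  · have h₁ : i ∈ G1 p η → i ∈ M := fun h => by
      by_contra h'
      exact absurd (min'_le _ i (mem_sdiff.2 ⟨h, h'⟩)) hi.not_ge
    have h₂ : i ∈ M → i ∈ G1 p η := fun h => by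
      by_contra h'
      exact absurd (lt_of_excess_addBoxes_eq hp hM he h h' hj.1 hj.2) hi.not_gt
    have h₃ : i ∈ M ↔ i ∈ G1 p η := ⟨h₂, h₁⟩
    simp [addBoxes, h₃]
  · simp [addBoxes, hj.1, hj.2]

/-- The first row `k` where `μ` and `η` differ is still the first difference after the boxes are
added, because equal excess means equal multisets of parts. -/
theorem key_topBoxes_lt {p : ℕ} (hp : p ≤ N) {μ η : Fin N → ℕ} (he : excess μ = excess η)
    (hlex : toLex μ < toLex η) : key (topBoxes p μ) < key (topBoxes p η) := by
  refine key_lt_iff.2 (Or.inr ⟨?_, ?_⟩)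
  · exact le_antisymm (excess_addBoxes_le_topBoxes hp he.le (card_G1 hp _))
      (excess_addBoxes_le_topBoxes hp he.ge (card_G1 hp _))
  obtain ⟨k, hk, hlt⟩ := hlex
  replace hk : ∀ i < k, μ i = η i := hk
  replace hlt : μ k < η k := hlt
  have hsplit : ∀ (f : Fin N → ℕ) (i : Fin N), colegLength f i =
      (univ.filter fun j => f i < f j).card + (univ.filter fun j => f i = f j ∧ j < i).card := by
    intro f i
    rw [colegLength_eq_card, ← card_union_of_disjoint]
    · congr 1
      ext j
      simp only [mem_union, mem_filter, mem_univ, true_and]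
      rfl
    · rw [disjoint_filter]
      intro j _ h₁ h₂
      omega
  -- The number of longer rows depends only on the multiset of parts, and ties are broken by rows
  -- before `i`, where `μ` and `η` agree.
  have hcount : ∀ i < k, colegLength μ i = colegLength η i := by
    intro i hi
    rw [hsplit, hsplit, hk i hi, card_filter_lt_eq_of_excess_eq he]
    congr 2
    ext j
    simp only [mem_filter, mem_univ, true_and]
    constructor <;> rintro ⟨h₁, h₂⟩ <;> refine ⟨?_, h₂⟩
    · rw [← hk j (h₂.trans hi)]; exact h₁
    · rw [hk j (h₂.trans hi)]; exact h₁
  refine ⟨k, fun i hi => ?_, ?_⟩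
  · change topBoxes p μ i = topBoxes p η i
    simp only [topBoxes_apply, hk i hi, hcount i hi]
  · change topBoxes p μ k < topBoxes p η k
    -- Rows preceding `k` in `η` have length at least `η k > μ k`, and `μ` has equally many parts
    -- larger than `μ k`. So if row `k` of `μ` gets a box, row `k` of `η` does too.
    have hle : colegLength η k ≤ colegLength μ k := by
      refine le_trans ?_ ((hsplit μ k).symm ▸ Nat.le_add_right _ _)
      rw [card_filter_lt_eq_of_excess_eq he, colegLength_eq_card]
      refine card_le_card fun j hj => ?_
      simp only [mem_filter, mem_univ, true_and] at hj ⊢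
      unfold Precedes at *
      omega
    rw [topBoxes_apply, topBoxes_apply]
    split_ifs <;> omega

theorem key_addBoxes_lt_topBoxes_of_key_lt {p : ℕ} (hp : p ≤ N) {μ η : Fin N → ℕ}
    (h : key μ < key η) {M : Finset (Fin N)} (hM : M.card = p) :
    key (addBoxes μ M) < key (topBoxes p η) := by
  rcases key_lt_iff.1 h with h | ⟨he, hlex⟩
  · refine key_lt_of_excess_le (excess_addBoxes_le_topBoxes hp h.le hM) fun he => ?_
    exact absurd (excess_eq_of_addBoxes_eq_topBoxes hp h.le hM he) h.ne
  · by_cases hM' : M = G1 p μ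
    · exact hM' ▸ key_topBoxes_lt hp he hlex
    · exact (key_addBoxes_lt_topBoxes hp hM hM').trans (key_topBoxes_lt hp he hlex)

/-! ### The eigenvalues -/

theorem Precedes.eigenvalue_lt {α : ℝ} (hα : 0 < α) {η : Fin N → ℕ} {k i : Fin N}
    (h : Precedes η k i) : eigenvalue α η i < eigenvalue α η k := by
  have h₁ : (colegLength η k : ℝ) < colegLength η i := by exact_mod_cast h.colegLength_lt
  have h₂ : (η i : ℝ) ≤ η k := by
    rcases h with h | h
    · exact_mod_cast h.le
    · exact_mod_cast h.1.le
  have h₃ := mul_le_mul_of_nonneg_left h₂ hα.le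
  simp only [eigenvalue]
  linarith

theorem eigenvalue_lt_iff {α : ℝ} (hα : 0 < α) {η : Fin N → ℕ} {k i : Fin N} :
    eigenvalue α η i < eigenvalue α η k ↔ Precedes η k i := by
  refine ⟨fun h => ?_, Precedes.eigenvalue_lt hα⟩
  rcases precedes_or_precedes η (show k ≠ i by rintro rfl; exact lt_irrefl _ h) with h' | h'
  · exact h'
  · exact absurd (h'.eigenvalue_lt hα) h.le.not_gt

/-- The ordering of the eigenvalues recovers the sorted order of the rows, hence `l'`; then the
parts can be solved for. -/
theorem eigenvalue_injective {α : ℝ} (hα : 0 < α) :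
    Function.Injective (eigenvalue α : (Fin N → ℕ) → Fin N → ℝ) := by
  intro μ η h
  funext i
  have hc : colegLength μ i = colegLength η i := by
    simp only [colegLength_eq_card, ← eigenvalue_lt_iff hα, h]
  have h' := congrFun h i
  simp only [eigenvalue, hc, sub_left_inj] at h'
  exact_mod_cast mul_left_cancel₀ hα.ne' h'

end

/-! ### The operators `ξ_i` and their triangular action on monomials. -/

section

open Finset MvPolynomial

/-! ### Divided differences -/

theorem X_sub_X_ne_zero {i q : Fin N} (h : i ≠ q) : (X i - X q : MvPolynomial (Fin N) ℝ) ≠ 0 :=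
  sub_ne_zero.2 fun h' => h (X_injective h')

theorem divDiff_eq {i q : Fin N} (h : i ≠ q) {f g : MvPolynomial (Fin N) ℝ}
    (hg : (X i - X q) * g = f - rename (Equiv.swap i q) f) : divDiff i q f = g :=
  mul_left_cancel₀ (X_sub_X_ne_zero h) ((sub_mul_divDiff i q f).trans hg.symm)

theorem divDiff_add {i q : Fin N} (h : i ≠ q) (f g : MvPolynomial (Fin N) ℝ) :
    divDiff i q (f + g) = divDiff i q f + divDiff i q g :=
  divDiff_eq h (by rw [mul_add, sub_mul_divDiff, sub_mul_divDiff, map_add]; ring)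

theorem divDiff_smul {i q : Fin N} (h : i ≠ q) (c : ℝ) (f : MvPolynomial (Fin N) ℝ) :
    divDiff i q (c • f) = c • divDiff i q f :=
  divDiff_eq h (by rw [mul_smul_comm, sub_mul_divDiff, map_smul, smul_sub])

theorem rename_divDiff (σ : Equiv.Perm (Fin N)) {i q : Fin N} (h : i ≠ q)
    (f : MvPolynomial (Fin N) ℝ) :
    rename σ (divDiff i q f) = divDiff (σ i) (σ q) (rename σ f) := by
  refine (divDiff_eq (σ.injective.ne h) ?_).symm
  have := congrArg (rename σ) (sub_mul_divDiff i q f)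
  rw [map_mul, map_sub, map_sub, rename_X, rename_X] at this
  rw [this, rename_rename, rename_rename]
  congr 3
  funext k
  simp only [Function.comp_apply]
  rw [← Equiv.Perm.mul_apply, ← Equiv.Perm.mul_apply, Equiv.mul_swap_eq_swap_mul]

theorem divDiff_X_mul_left {i q : Fin N} (h : i ≠ q) (g : MvPolynomial (Fin N) ℝ) :
    divDiff i q (X i * g) = X q * divDiff i q g + g := by
  refine divDiff_eq h ?_
  rw [map_mul, rename_X, Equiv.swap_apply_left]
  linear_combination X q * sub_mul_divDiff i q g

theorem divDiff_X_mul_right {i q : Fin N} (h : i ≠ q) (g : MvPolynomial (Fin N) ℝ) :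
    divDiff i q (X q * g) = X i * divDiff i q g - g := by
  refine divDiff_eq h ?_
  rw [map_mul, rename_X, Equiv.swap_apply_right]
  linear_combination X i * sub_mul_divDiff i q g

theorem divDiff_X_mul_of_ne {i q k : Fin N} (h : i ≠ q) (hi : k ≠ i) (hq : k ≠ q)
    (g : MvPolynomial (Fin N) ℝ) : divDiff i q (X k * g) = X k * divDiff i q g := by
  refine divDiff_eq h ?_
  rw [map_mul, rename_X, Equiv.swap_apply_of_ne_of_ne hi hq]
  linear_combination X k * sub_mul_divDiff i q g

/-! ### The operators `ξ_i` as linear maps -/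

/-- The factor in front of the divided difference in `ξ_i`. -/
noncomputable def weight (i q : Fin N) : MvPolynomial (Fin N) ℝ := if q < i then X i else X q

theorem xi_eq (α : ℝ) (i : Fin N) (f : MvPolynomial (Fin N) ℝ) :
    xi α i f = α • (X i * pderiv i f) + ∑ q ∈ univ.erase i, weight i q * divDiff i q f
      - (i.val : ℝ) • f := by
  have hu : (univ.erase i : Finset (Fin N)) = univ.filter (· < i) ∪ univ.filter (i < ·) := by
    ext q
    simp only [mem_erase, mem_univ, mem_union, mem_filter, true_and, and_true]
    omega
  rw [xi, hu, sum_union, ← add_assoc]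
  · congr 2
    · congr 1
      exact sum_congr rfl fun q hq => by rw [weight, if_pos (mem_filter.1 hq).2]
    · exact sum_congr rfl fun q hq => by rw [weight, if_neg (mem_filter.1 hq).2.not_gt]
  · rw [disjoint_filter]
    intro q _ h₁ h₂
    exact absurd h₁ h₂.not_gt

/-- The operator `ξ_i` as a linear map. -/
noncomputable def xiLinear (α : ℝ) (i : Fin N) :
    MvPolynomial (Fin N) ℝ →ₗ[ℝ] MvPolynomial (Fin N) ℝ where
  toFun := xi α i
  map_add' f g := by
    have : ∀ q ∈ univ.erase i, weight i q * divDiff i q (f + g) =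
        weight i q * divDiff i q f + weight i q * divDiff i q g := fun q hq => by
      rw [divDiff_add (ne_of_mem_erase hq).symm, mul_add]
    rw [xi_eq, xi_eq, xi_eq, sum_congr rfl this, sum_add_distrib, map_add, mul_add, smul_add,
      smul_add]
    abel
  map_smul' c f := by
    have : ∀ q ∈ univ.erase i, weight i q * divDiff i q (c • f) =
        c • (weight i q * divDiff i q f) := fun q hq => by
      rw [divDiff_smul (ne_of_mem_erase hq).symm, mul_smul_comm]
    rw [xi_eq, xi_eq, sum_congr rfl this, ← smul_sum, Derivation.map_smul, mul_smul_comm, smul_comm α c,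
      smul_comm _ c f, RingHom.id_apply, smul_sub, smul_add]

@[simp]
theorem xiLinear_apply (α : ℝ) (i : Fin N) (f : MvPolynomial (Fin N) ℝ) :
    xiLinear α i f = xi α i f := rfl

/-! ### Monomials -/

/-- The monomial `z^η`. -/
noncomputable def mono (η : Fin N → ℕ) : MvPolynomial (Fin N) ℝ :=
  monomial (Finsupp.equivFunOnFinite.symm η) 1

/-- The coefficient of the monomial `z^η`, as a linear functional. -/
noncomputable def coeffAt (η : Fin N → ℕ) : MvPolynomial (Fin N) ℝ →ₗ[ℝ] ℝ :=
  lcoeff ℝ (Finsupp.equivFunOnFinite.symm η)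

theorem coeffAt_apply (η : Fin N → ℕ) (f : MvPolynomial (Fin N) ℝ) :
    coeffAt η f = coeff (Finsupp.equivFunOnFinite.symm η) f := rfl

theorem coeffAt_mono (μ η : Fin N → ℕ) : coeffAt μ (mono η) = if η = μ then 1 else 0 := by
  rw [coeffAt_apply, mono, coeff_monomial]
  simp only [EmbeddingLike.apply_eq_iff_eq]

theorem ext_coeffAt {f g : MvPolynomial (Fin N) ℝ} (h : ∀ η, coeffAt η f = coeffAt η g) :
    f = g := by
  ext m
  simpa [coeffAt_apply] using h m

theorem mono_eq_prod (η : Fin N → ℕ) : mono η = ∏ j, X j ^ η j := by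
  rw [mono, monomial_eq, C_1, one_mul, Finsupp.prod_fintype _ _ (fun _ => pow_zero _)]
  rfl

theorem rename_mono (σ : Equiv.Perm (Fin N)) (η : Fin N → ℕ) :
    rename σ (mono η) = mono (η ∘ σ.symm) := by
  rw [mono_eq_prod, mono_eq_prod, map_prod,
    ← Equiv.prod_comp σ fun j => X j ^ (η ∘ σ.symm) j]
  simp

theorem mono_mul_mono (μ η : Fin N → ℕ) : mono μ * mono η = mono (μ + η) := by
  simp only [mono_eq_prod, ← prod_mul_distrib, ← pow_add, Pi.add_apply]

theorem eq_sum_mono (f : MvPolynomial (Fin N) ℝ) :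
    f = ∑ m ∈ f.support, coeffAt (m : Fin N → ℕ) f • mono (m : Fin N → ℕ) := by
  conv_lhs => rw [f.as_sum]
  refine sum_congr rfl fun m _ => ?_
  simp [coeffAt_apply, mono, smul_monomial]

/-! ### Triangularity -/

/-- The span of the monomials below `z^η`. -/
noncomputable def lowerSpan (η : Fin N → ℕ) : Submodule ℝ (MvPolynomial (Fin N) ℝ) :=
  Submodule.span ℝ (mono '' {μ | key μ < key η})

theorem mono_mem_lowerSpan {μ η : Fin N → ℕ} (h : key μ < key η) : mono μ ∈ lowerSpan η :=
  Submodule.subset_span ⟨μ, h, rfl⟩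

theorem coeffAt_eq_zero_of_mem_lowerSpan {κ η : Fin N → ℕ} (h : ¬ key κ < key η)
    {f : MvPolynomial (Fin N) ℝ} (hf : f ∈ lowerSpan η) : coeffAt κ f = 0 := by
  have : lowerSpan η ≤ LinearMap.ker (coeffAt κ) := by
    refine Submodule.span_le.2 ?_
    rintro _ ⟨μ, hμ, rfl⟩
    rw [SetLike.mem_coe, LinearMap.mem_ker, coeffAt_mono, if_neg]
    rintro rfl
    exact h hμ
  exact this hf

/-- The composition `η` with the parts `i` and `q` replaced by `x` and `y`. -/
def setPair (η : Fin N → ℕ) (i q : Fin N) (x y : ℕ) : Fin N → ℕ :=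
  Function.update (Function.update η i x) q y

theorem setPair_self (η : Fin N → ℕ) (i q : Fin N) : setPair η i q (η i) (η q) = η := by
  simp [setPair]

theorem setPair_comp_swap (η : Fin N → ℕ) (i q : Fin N) :
    η ∘ Equiv.swap i q = setPair η i q (η q) (η i) := by
  funext k
  rcases eq_or_ne k q with rfl | hq
  · simp [setPair]
  · rcases eq_or_ne k i with rfl | hi
    · simp [setPair, hq]
    · simp [setPair, hq, hi, Equiv.swap_apply_of_ne_of_ne]

theorem sum_setPair {A : Type*} [AddCommMonoid A] (g : Fin N → ℕ → A) (η : Fin N → ℕ)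
    {i q : Fin N} (h : i ≠ q) (x y : ℕ) :
    ∑ k, g k (setPair η i q x y k) =
      g i x + (g q y + ∑ k ∈ (univ.erase i).erase q, g k (η k)) := by
  rw [← add_sum_erase _ _ (mem_univ i), ← add_sum_erase _ _ (mem_erase.2 ⟨h.symm, mem_univ q⟩)]
  congr 1
  · simp [setPair, h]
  · congr 1
    · simp [setPair]
    · refine sum_congr rfl fun k hk => ?_
      simp only [mem_erase, mem_univ, and_true] at hk
      simp [setPair, hk.1, hk.2]

theorem mono_setPair (η : Fin N → ℕ) {i q : Fin N} (h : i ≠ q) (x y : ℕ) :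
    mono (setPair η i q x y) =
      X i ^ x * (X q ^ y * ∏ k ∈ (univ.erase i).erase q, X k ^ η k) := by
  rw [mono_eq_prod]
  exact congrArg Additive.toMul
    (sum_setPair (fun k x => Additive.ofMul (X k ^ x : MvPolynomial (Fin N) ℝ)) η h x y)

/-- Two parts moved strictly closer together with fixed sum never increase the excess; at `t = a -
1`, just below the longer part, it drops. -/
theorem key_setPair_lt {η : Fin N → ℕ} {i q : Fin N} (h : i ≠ q) {x y : ℕ}
    (hs : x + y = η i + η q) {a : ℕ} (hx : x < a) (hy : y < a) (ha : a = η i ∨ a = η q) :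
    key (setPair η i q x y) < key η := by
  have hex : ∀ t, excess (setPair η i q x y) t =
      (x - t) + ((y - t) + ∑ k ∈ (univ.erase i).erase q, (η k - t)) :=
    fun t => sum_setPair (fun _ x => x - t) η h x y
  have hex' : ∀ t, excess η t =
      (η i - t) + ((η q - t) + ∑ k ∈ (univ.erase i).erase q, (η k - t)) := fun t => by
    conv_lhs => rw [← setPair_self η i q]
    exact sum_setPair (fun _ x => x - t) η h _ _
  refine key_lt_of_excess_le (fun t => ?_) fun he => ?_
  · change excess (setPair η i q x y) t ≤ excess η t
    rw [hex, hex']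
    omega
  · have := congrFun he (a - 1)
    rw [hex, hex'] at this
    omega

theorem key_comp_swap_lt {η : Fin N → ℕ} {i q : Fin N} (h : i < q) (hη : η q < η i) :
    key (η ∘ Equiv.swap i q) < key η := by
  refine key_lt_iff.2 (Or.inr ⟨excess_comp_perm η _, i, fun k hk => ?_, ?_⟩)
  · change η (Equiv.swap i q k) = η k
    rw [Equiv.swap_apply_of_ne_of_ne hk.ne (hk.trans h).ne]
  · change η (Equiv.swap i q i) < η i
    rwa [Equiv.swap_apply_left]

theorem sub_mul_sum_pow_mul_pow {A : Type*} [CommRing A] (x y r : A) (b c : ℕ) :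
    (x - y) * (x ^ (b + c + 1) * (y ^ b * r) +
      ∑ m ∈ range c, x ^ (b + m + 1) * (y ^ (b + (c - m)) * r)) =
    x * (x ^ (b + c + 1) * (y ^ b * r) - x ^ b * (y ^ (b + c + 1) * r)) := by
  have h₁ := geom_sum₂_mul x y (c + 1)
  have h₂ : x ^ (b + c + 1) * (y ^ b * r) +
      ∑ m ∈ range c, x ^ (b + m + 1) * (y ^ (b + (c - m)) * r) =
      x ^ (b + 1) * y ^ b * r * ∑ m ∈ range (c + 1), x ^ m * y ^ (c + 1 - 1 - m) := by
    rw [sum_range_succ, mul_add, add_comm, mul_sum]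
    congr 1
    · refine sum_congr rfl fun m _ => ?_
      rw [Nat.add_sub_cancel, pow_add y]
      ring
    · rw [Nat.add_sub_cancel, Nat.sub_self]
      ring
  rw [h₂]
  linear_combination (x ^ (b + 1) * y ^ b * r) * h₁

theorem exists_mul_eq_sub {η : Fin N → ℕ} {i q : Fin N} (h : i ≠ q) {a b : ℕ} (hab : b < a)
    (hs : a + b = η i + η q) (hm : a = η i ∨ a = η q) :
    ∃ L ∈ lowerSpan η, (X i - X q) * (mono (setPair η i q a b) + L) =
      X i * (mono (setPair η i q a b) - mono (setPair η i q b a)) := by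
  -- `c` is the number of exponents strictly between `b` and `a`. In the geometric sum for the
  -- quotient, the end term is the leading monomial and these `c` terms form the lower part `L`.
  obtain ⟨c, rfl⟩ : ∃ c, a = b + c + 1 := ⟨a - b - 1, by omega⟩
  refine ⟨∑ m ∈ range c, mono (setPair η i q (b + m + 1) (b + (c - m))),
    Submodule.sum_mem _ fun m hm' => mono_mem_lowerSpan
      (key_setPair_lt (a := b + c + 1) h ?_ ?_ ?_ hm), ?_⟩
  · have := mem_range.1 hm'
    omega
  · have := mem_range.1 hm'
    omega
  · have := mem_range.1 hm'
    omega
  · simp only [mono_setPair η h]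
    exact sub_mul_sum_pow_mul_pow _ _ _ _ _

theorem X_mul_divDiff_mono {η : Fin N → ℕ} {i q : Fin N} (h : i ≠ q) :
    ∃ L ∈ lowerSpan η, X i * divDiff i q (mono η) =
      (if η q < η i then mono η + L
        else if η i < η q then - (mono (η ∘ Equiv.swap i q) + L) else 0) := by
  have hD : (X i - X q) * (X i * divDiff i q (mono η)) =
      X i * (mono η - mono (η ∘ Equiv.swap i q)) := by
    have := sub_mul_divDiff i q (mono η)
    rw [rename_mono, Equiv.symm_swap] at this
    linear_combination X i * this
  rw [setPair_comp_swap] at hD ⊢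
  rcases lt_trichotomy (η q) (η i) with hlt | heq | hlt
  · obtain ⟨L, hL, hLe⟩ := exists_mul_eq_sub (η := η) h hlt rfl (Or.inl rfl)
    rw [setPair_self] at hLe
    refine ⟨L, hL, ?_⟩
    rw [if_pos hlt]
    exact mul_left_cancel₀ (X_sub_X_ne_zero h) (hD.trans hLe.symm)
  · refine ⟨0, Submodule.zero_mem _, ?_⟩
    rw [if_neg heq.not_lt, if_neg heq.not_gt]
    refine mul_left_cancel₀ (X_sub_X_ne_zero h) (hD.trans ?_)
    have : setPair η i q (η q) (η i) = η := by
      conv_rhs => rw [← setPair_self η i q]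
      rw [heq]
    rw [this, sub_self]
    ring
  · obtain ⟨L, hL, hLe⟩ := exists_mul_eq_sub (η := η) h hlt (add_comm _ _)
      (Or.inr rfl)
    rw [setPair_self] at hLe
    refine ⟨L, hL, ?_⟩
    rw [if_neg hlt.not_gt, if_pos hlt]
    refine mul_left_cancel₀ (X_sub_X_ne_zero h) (hD.trans ?_)
    linear_combination hLe

/-- The contribution of row `q` to the diagonal entry. For `q < i` it is `0` or `-1` shifted from
`1`, so that summing the first indicator later cancels the constant `-i`, and the second one gives
`l'`. -/
theorem weight_mul_divDiff_mono_sub_mem {η : Fin N → ℕ} {i q : Fin N} (h : q ≠ i) :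
    weight i q * divDiff i q (mono η) -
      ((if q < i then 1 else 0) - (if Precedes η q i then 1 else 0) : ℝ) • mono η
        ∈ lowerSpan η := by
  obtain ⟨L, hL, hLe⟩ := X_mul_divDiff_mono (η := η) h.symm
  -- The weight `z_q` is reduced to `z_i` by the defining relation of the quotient.
  have hq : X q * divDiff i q (mono η) =
      X i * divDiff i q (mono η) - mono η + mono (η ∘ Equiv.swap i q) := by
    have := sub_mul_divDiff i q (mono η)
    rw [rename_mono, Equiv.symm_swap] at this
    linear_combination - this
  rcases h.lt_or_gt with hqi | hqi
  · rw [weight, if_pos hqi, if_pos hqi, hLe]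
    rcases lt_trichotomy (η q) (η i) with hlt | heq | hlt
    · have : ¬ Precedes η q i := by unfold Precedes; omega
      rw [if_pos hlt, if_neg this]
      simpa using hL
    · have : Precedes η q i := by unfold Precedes; omega
      rw [if_neg heq.not_lt, if_neg heq.not_gt, if_pos this]
      simp
    · have : Precedes η q i := by unfold Precedes; omega
      rw [if_neg hlt.not_gt, if_pos hlt, if_pos this, sub_self, zero_smul, sub_zero]
      refine Submodule.neg_mem _ (Submodule.add_mem _ (mono_mem_lowerSpan ?_) hL)
      rw [Equiv.swap_comm]
      exact key_comp_swap_lt hqi hlt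
  · rw [weight, if_neg hqi.not_gt, if_neg hqi.not_gt, hq, hLe]
    rcases lt_trichotomy (η q) (η i) with hlt | heq | hlt
    · have : ¬ Precedes η q i := by unfold Precedes; omega
      rw [if_pos hlt, if_neg this, sub_self, zero_smul, sub_zero, add_sub_cancel_left]
      exact Submodule.add_mem _ hL (mono_mem_lowerSpan (key_comp_swap_lt hqi hlt))
    · have : ¬ Precedes η q i := by unfold Precedes; omega
      have hs : η ∘ Equiv.swap i q = η := by
        rw [setPair_comp_swap]
        conv_rhs => rw [← setPair_self η i q]
        rw [heq]
      rw [if_neg heq.not_lt, if_neg heq.not_gt, if_neg this, hs]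
      simp
    · have : Precedes η q i := by unfold Precedes; omega
      rw [if_neg hlt.not_gt, if_pos hlt, if_pos this]
      convert Submodule.neg_mem _ hL using 1
      rw [zero_sub, neg_smul, one_smul]
      abel

theorem X_mul_pderiv_mono (η : Fin N → ℕ) (i : Fin N) :
    X i * pderiv i (mono η) = (η i : ℝ) • mono η := by
  rw [mono, X_mul_pderiv_monomial, ← Nat.cast_smul_eq_nsmul ℝ]
  rfl

theorem xi_mono_sub_mem (α : ℝ) (η : Fin N → ℕ) (i : Fin N) :
    xi α i (mono η) - eigenvalue α η i • mono η ∈ lowerSpan η := by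
  have hsum := Submodule.sum_mem (lowerSpan η) fun q (hq : q ∈ univ.erase i) =>
    weight_mul_divDiff_mono_sub_mem (η := η) (ne_of_mem_erase hq)
  rw [sum_sub_distrib, ← sum_smul, sum_sub_distrib] at hsum
  have h₁ : ∑ q ∈ univ.erase i, (if q < i then 1 else 0 : ℝ) = i.val := by
    rw [sum_erase _ (by simp), sum_boole, filter_gt_eq_Iio, Fin.card_Iio]
  have h₂ : ∑ q ∈ univ.erase i, (if Precedes η q i then 1 else 0 : ℝ) = colegLength η i := by
    rw [sum_erase _ (by simp [not_precedes_self]), sum_boole, colegLength_eq_card]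
  rw [h₁, h₂] at hsum
  convert hsum using 1
  rw [xi_eq, X_mul_pderiv_mono, eigenvalue]
  module

end

/-! ### Joint eigenfunctions: uniqueness, existence, expansions, and the leading Pieri coefficient.
-/

section

open Finset MvPolynomial

/-! ### Leading monomials and uniqueness -/

theorem exists_maximal_of_ne_zero {c : (Fin N → ℕ) → ℝ} (hc : (Function.support c).Finite)
    {κ : Fin N → ℕ} (h : c κ ≠ 0) :
    ∃ m, key κ ≤ key m ∧ c m ≠ 0 ∧ ∀ m', c m' ≠ 0 → ¬ key m < key m' := by
  obtain ⟨b, hb, hmax⟩ := (hc.image key).exists_le_maximal ⟨κ, h, rfl⟩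
  obtain ⟨m, hm, rfl⟩ := hmax.prop
  exact ⟨m, hb, hm, fun m' hm' => hmax.not_gt ⟨m', hm', rfl⟩⟩

theorem finite_support_coeffAt (f : MvPolynomial (Fin N) ℝ) :
    (Function.support fun κ => coeffAt κ f).Finite := by
  refine ((Finset.finite_toSet f.support).image fun m : Fin N →₀ ℕ => (m : Fin N → ℕ)).subset fun κ hκ => ?_
  exact ⟨Finsupp.equivFunOnFinite.symm κ, mem_support_iff.2 hκ, rfl⟩

theorem coeffAt_xi_mono {α : ℝ} {κ m : Fin N → ℕ} (h : ¬ key κ < key m) (i : Fin N) :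
    coeffAt κ (xi α i (mono m)) = eigenvalue α κ i * coeffAt κ (mono m) := by
  have := coeffAt_eq_zero_of_mem_lowerSpan h (xi_mono_sub_mem α m i)
  rw [map_sub, map_smul, sub_eq_zero, smul_eq_mul] at this
  rw [this, coeffAt_mono]
  split_ifs with hm
  · rw [hm]
  · simp

/-- By triangularity only monomials above `z^κ` could contribute off the diagonal, and maximality
excludes them. -/
theorem coeffAt_xi_of_maximal {α : ℝ} {f : MvPolynomial (Fin N) ℝ} {κ : Fin N → ℕ}
    (h : ∀ m, coeffAt m f ≠ 0 → ¬ key κ < key m) (i : Fin N) :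
    coeffAt κ (xi α i f) = eigenvalue α κ i * coeffAt κ f := by
  conv_lhs => rw [eq_sum_mono f, ← xiLinear_apply]
  conv_rhs => rw [eq_sum_mono f]
  simp only [map_sum, map_smul, xiLinear_apply, mul_sum, smul_eq_mul]
  refine sum_congr rfl fun m hm => ?_
  rw [coeffAt_xi_mono (h _ _)]
  · ring
  · rw [coeffAt_apply, Finsupp.equivFunOnFinite_symm_coe]
    exact mem_support_iff.1 hm

/-- `P` is a simultaneous eigenfunction with the eigenvalues of `η`. -/
def IsEigen (α : ℝ) (η : Fin N → ℕ) (P : MvPolynomial (Fin N) ℝ) : Prop :=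
  ∀ i, xi α i P = eigenvalue α η i • P

/-- At a maximal exponent the eigenvalues of `P` must be those of that exponent, and these determine
it. Both the leading term and uniqueness rest on this. -/
theorem IsEigen.eq_of_maximal {α : ℝ} (hα : 0 < α) {η : Fin N → ℕ} {P : MvPolynomial (Fin N) ℝ}
    (h : IsEigen α η P) {κ : Fin N → ℕ} (hκ : coeffAt κ P ≠ 0)
    (hmax : ∀ m, coeffAt m P ≠ 0 → ¬ key κ < key m) : κ = η := by
  refine eigenvalue_injective hα (funext fun i => ?_)
  have := coeffAt_xi_of_maximal (α := α) hmax i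
  rw [h i, map_smul, smul_eq_mul] at this
  exact (mul_right_cancel₀ hκ this).symm

theorem IsEigen.key_le {α : ℝ} (hα : 0 < α) {η : Fin N → ℕ} {P : MvPolynomial (Fin N) ℝ}
    (h : IsEigen α η P) {κ : Fin N → ℕ} (hκ : coeffAt κ P ≠ 0) : key κ ≤ key η := by
  obtain ⟨m, hle, hm, hmax⟩ := exists_maximal_of_ne_zero (finite_support_coeffAt P) hκ
  rwa [h.eq_of_maximal hα hm hmax] at hle

theorem IsEigen.eq_zero {α : ℝ} (hα : 0 < α) {η : Fin N → ℕ} {P : MvPolynomial (Fin N) ℝ}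
    (h : IsEigen α η P) (h0 : coeffAt η P = 0) : P = 0 := by
  refine ext_coeffAt fun κ => ?_
  rw [map_zero]
  by_contra hκ
  obtain ⟨m, -, hm, hmax⟩ := exists_maximal_of_ne_zero (finite_support_coeffAt P) hκ
  rw [h.eq_of_maximal hα hm hmax] at hm
  exact hm h0

theorem IsEigen.sub {α : ℝ} {η : Fin N → ℕ} {P Q : MvPolynomial (Fin N) ℝ}
    (hP : IsEigen α η P) (hQ : IsEigen α η Q) : IsEigen α η (P - Q) := fun i => by
  rw [← xiLinear_apply, map_sub, xiLinear_apply, xiLinear_apply, hP i, hQ i, smul_sub]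

theorem isNonsymmJack_iff {α : ℝ} {η : Fin N → ℕ} {P : MvPolynomial (Fin N) ℝ} :
    IsNonsymmJack α η P ↔ IsEigen α η P ∧ coeffAt η P = 1 := Iff.rfl

theorem IsNonsymmJack.unique {α : ℝ} (hα : 0 < α) {η : Fin N → ℕ}
    {P Q : MvPolynomial (Fin N) ℝ} (hP : IsNonsymmJack α η P) (hQ : IsNonsymmJack α η Q) :
    P = Q := by
  rw [isNonsymmJack_iff] at hP hQ
  exact sub_eq_zero.1 ((hP.1.sub hQ.1).eq_zero hα (by rw [map_sub, hP.2, hQ.2, sub_self]))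

/-! ### Intertwining relations -/

theorem coeffAt_rename (σ : Equiv.Perm (Fin N)) (η : Fin N → ℕ) (f : MvPolynomial (Fin N) ℝ) :
    coeffAt (η ∘ σ.symm) (rename σ f) = coeffAt η f := by
  rw [coeffAt_apply, coeffAt_apply, ← coeff_rename_mapDomain σ σ.injective f]
  congr 1
  ext k
  obtain ⟨j, rfl⟩ := σ.surjective k
  rw [Finsupp.mapDomain_apply σ.injective]
  simp

theorem rename_xi (α : ℝ) (σ : Equiv.Perm (Fin N)) (i : Fin N) (f : MvPolynomial (Fin N) ℝ) :
    rename σ (xi α i f) = α • (X (σ i) * pderiv (σ i) (rename σ f)) +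
      ∑ q ∈ univ.erase (σ i), (if σ.symm q < i then X (σ i) else X q) *
        divDiff (σ i) q (rename σ f) - (i.val : ℝ) • rename σ f := by
  have hs : (univ.erase (σ i) : Finset (Fin N)) = (univ.erase i).map σ.toEmbedding := by
    ext q
    obtain ⟨k, rfl⟩ := σ.surjective q
    simp
  rw [xi_eq, map_sub, map_add, map_smul, map_smul, map_mul, rename_X,
    pderiv_rename σ.injective, map_sum, hs, sum_map]
  congr 2
  refine sum_congr rfl fun q hq => ?_
  rw [map_mul, rename_divDiff σ (ne_of_mem_erase hq).symm, weight]
  simp only [Equiv.coe_toEmbedding, Equiv.symm_apply_apply]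
  split_ifs <;> rw [rename_X]

/-- A relation of the degenerate affine Hecke algebra; with its mirror image it lets an adjacent
swap carry one eigenfunction to another. -/
theorem xi_rename_swap_right (α : ℝ) {a b : Fin N} (hab : b.val = a.val + 1)
    (f : MvPolynomial (Fin N) ℝ) :
    xi α b (rename (Equiv.swap a b) f) = rename (Equiv.swap a b) (xi α a f) - f := by
  have hne : a ≠ b := by rintro rfl; omega
  have hf : rename (Equiv.swap b a) (rename (Equiv.swap a b) f) = f := by
    rw [rename_rename, Equiv.swap_comm, ← Equiv.coe_trans, Equiv.swap_swap]
    simp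
  rw [rename_xi, Equiv.swap_apply_left, xi_eq, Equiv.symm_swap]
  set g := rename (Equiv.swap a b) f
  -- Only the term `q = a` has a different weight; it contributes `g - f`, and the `g` cancels
  -- against the change of constant from `-a` to `-(a + 1)`.
  have hsum : ∑ q ∈ univ.erase b, weight b q * divDiff b q g =
      ∑ q ∈ univ.erase b, (if Equiv.swap a b q < a then X b else X q) * divDiff b q g
        + (g - f) := by
    rw [← sub_eq_iff_eq_add', ← sum_sub_distrib, sum_eq_single a]
    · have hlt : a < b := by rw [Fin.lt_def]; omega
      rw [Equiv.swap_apply_left, if_neg hlt.not_gt, weight, if_pos hlt, ← sub_mul,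
        sub_mul_divDiff, hf]
    · intro q hq hqa
      have hqb := ne_of_mem_erase hq
      have : q < a ↔ q < b := by
        rw [Fin.lt_def, Fin.lt_def, hab]
        have := Fin.val_ne_of_ne hqa
        omega
      simp [weight, Equiv.swap_apply_of_ne_of_ne hqa hqb, this]
    · intro h
      exact absurd (mem_erase.2 ⟨hne, mem_univ a⟩) h
  rw [hsum, hab]
  push_cast
  module

theorem xi_rename_swap_left (α : ℝ) {a b : Fin N} (hab : b.val = a.val + 1)
    (f : MvPolynomial (Fin N) ℝ) :
    xi α a (rename (Equiv.swap a b) f) = rename (Equiv.swap a b) (xi α b f) + f := by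
  have hs : ∀ g : MvPolynomial (Fin N) ℝ,
      rename (Equiv.swap a b) (rename (Equiv.swap a b) g) = g := fun g => by
    rw [rename_rename, ← Equiv.coe_trans, Equiv.swap_swap]
    simp
  have := congrArg (rename (Equiv.swap a b)) (xi_rename_swap_right α hab (rename (Equiv.swap a b) f))
  rw [hs, map_sub, hs, hs] at this
  rw [this]
  abel

theorem xi_rename_swap_of_ne (α : ℝ) {a b j : Fin N} (hab : b.val = a.val + 1) (hja : j ≠ a)
    (hjb : j ≠ b) (f : MvPolynomial (Fin N) ℝ) :
    xi α j (rename (Equiv.swap a b) f) = rename (Equiv.swap a b) (xi α j f) := by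
  rw [rename_xi, Equiv.swap_apply_of_ne_of_ne hja hjb, xi_eq, Equiv.symm_swap]
  congr 2
  refine sum_congr rfl fun q hq => ?_
  have : Equiv.swap a b q < j ↔ q < j := by
    have h₁ := Fin.val_ne_of_ne hja
    have h₂ := Fin.val_ne_of_ne hjb
    rw [Equiv.swap_apply_def]
    split_ifs with h h
    · subst h; rw [Fin.lt_def, Fin.lt_def]; omega
    · subst h; rw [Fin.lt_def, Fin.lt_def]; omega
    · rfl
  simp [weight, this]

/-- Adjacent positions compare alike with every third row, and rows `a` and `b` are never tied
because `η a ≠ η b`. -/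
theorem colegLength_comp_swap {a b : Fin N} (hab : b.val = a.val + 1) {η : Fin N → ℕ}
    (hη : η a ≠ η b) (j : Fin N) :
    colegLength (η ∘ Equiv.swap a b) j = colegLength η (Equiv.swap a b j) := by
  rw [colegLength_eq_card, colegLength_eq_card, ← card_map (Equiv.swap a b).toEmbedding]
  congr 1
  ext k
  obtain ⟨k, rfl⟩ := (Equiv.swap a b).surjective k
  simp only [mem_map_equiv, Equiv.symm_swap, Equiv.swap_apply_self, mem_filter, mem_univ,
    true_and]
  simp only [Precedes, Function.comp_apply]
  refine or_congr_right (and_congr_right fun h => ?_)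
  rw [Fin.lt_def, Fin.lt_def]
  simp only [Equiv.swap_apply_def, Fin.ext_iff] at h ⊢
  split_ifs at h ⊢ <;> simp_all <;> omega

theorem eigenvalue_comp_swap (α : ℝ) {a b : Fin N} (hab : b.val = a.val + 1) {η : Fin N → ℕ}
    (hη : η a ≠ η b) (j : Fin N) :
    eigenvalue α (η ∘ Equiv.swap a b) j = eigenvalue α η (Equiv.swap a b j) := by
  rw [eigenvalue, eigenvalue, colegLength_comp_swap hab hη, Function.comp_apply]

theorem exists_isNonsymmJack_comp_swap {α : ℝ} (hα : 0 < α) {a b : Fin N}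
    (hab : b.val = a.val + 1) {η : Fin N → ℕ} (hη : η a < η b)
    (h : ∃ P, IsNonsymmJack α η P) : ∃ P, IsNonsymmJack α (η ∘ Equiv.swap a b) P := by
  obtain ⟨P, hP, hc⟩ := h
  have hev : eigenvalue α η a < eigenvalue α η b :=
    Precedes.eigenvalue_lt hα (Or.inl hη)
  set d := eigenvalue α η b - eigenvalue α η a with hd
  have hd0 : d ≠ 0 := (sub_pos.2 hev).ne'
  have hlt : a < b := by rw [Fin.lt_def]; omega
  -- The intertwining relations preserve the span of `P` and its swap; the multiple `d⁻¹` of `P` is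
  -- what diagonalizes `ξ_a` and `ξ_b` there.
  refine ⟨rename (Equiv.swap a b) P + d⁻¹ • P, isNonsymmJack_iff.2 ⟨fun j => ?_, ?_⟩⟩
  · rw [eigenvalue_comp_swap α hab hη.ne, ← xiLinear_apply, map_add, map_smul, xiLinear_apply,
      xiLinear_apply, hP j]
    have h1 : P = (d⁻¹ * d) • P := by rw [inv_mul_cancel₀ hd0, one_smul]
    rcases eq_or_ne j a with rfl | hja
    · rw [xi_rename_swap_left α hab, hP b, Equiv.swap_apply_left, map_smul]
      nth_rewrite 2 [h1]
      rw [hd]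
      module
    rcases eq_or_ne j b with rfl | hjb
    · rw [xi_rename_swap_right α hab, hP a, Equiv.swap_apply_right, map_smul]
      nth_rewrite 2 [h1]
      rw [hd]
      module
    · rw [xi_rename_swap_of_ne α hab hja hjb, hP j, Equiv.swap_apply_of_ne_of_ne hja hjb,
        map_smul]
      module
  · have h₁ := coeffAt_rename (Equiv.swap a b) η P
    rw [Equiv.symm_swap] at h₁
    -- The swapped composition lies above `η`, so it is not an exponent of `P`, and the
    -- normalization survives.
    have h₂ : coeffAt (η ∘ Equiv.swap a b) P = 0 := by
      by_contra h0
      have h₃ := IsEigen.key_le hα hP h0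
      have h₄ := key_comp_swap_lt (η := η ∘ Equiv.swap a b) hlt (by simpa using hη)
      rw [Function.comp_assoc, ← Equiv.coe_trans, Equiv.swap_swap] at h₄
      exact absurd h₃ h₄.not_ge
    rw [map_add, map_smul, h₁, h₂, smul_zero, add_zero]
    exact hc

/-! ### The raising operator -/

/-- The composition `(η_2, …, η_N, η_1 + 1)`. -/
def raise {n : ℕ} (η : Fin (n + 1) → ℕ) : Fin (n + 1) → ℕ :=
  Fin.snoc (fun j : Fin n => η j.succ) (η 0 + 1)

/-- The polynomial `z_N f(z_N, z_1, …, z_{N-1})`. -/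
noncomputable def raiseOp {n : ℕ} (f : MvPolynomial (Fin (n + 1)) ℝ) :
    MvPolynomial (Fin (n + 1)) ℝ :=
  X (Fin.last n) * rename (finRotate (n + 1)).symm f

theorem finRotate_symm_zero (n : ℕ) : (finRotate (n + 1)).symm 0 = Fin.last n := by
  rw [Equiv.symm_apply_eq, finRotate_last]

theorem finRotate_symm_succ {n : ℕ} (j : Fin n) :
    (finRotate (n + 1)).symm j.succ = j.castSucc := by
  rw [Equiv.symm_apply_eq, finRotate_apply, Fin.coeSucc_eq_succ]

theorem finRotate_castSucc {n : ℕ} (j : Fin n) : finRotate (n + 1) j.castSucc = j.succ := by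
  rw [finRotate_apply, Fin.coeSucc_eq_succ]

/-- The divided difference against `z_N` yields an extra `-z_N g`, which matches the shift of the
constant from `-(j + 1)` to `-j`. -/
theorem xi_raiseOp_castSucc {n : ℕ} (α : ℝ) (j : Fin n) (f : MvPolynomial (Fin (n + 1)) ℝ) :
    xi α j.castSucc (raiseOp f) = raiseOp (xi α j.succ f) := by
  have hl : j.castSucc ≠ Fin.last n := (Fin.castSucc_lt_last j).ne
  rw [raiseOp, raiseOp, rename_xi, xi_eq, finRotate_symm_succ, Equiv.symm_symm]
  set g := rename (finRotate (n + 1)).symm f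
  have hp : pderiv j.castSucc (X (Fin.last n) * g) = X (Fin.last n) * pderiv j.castSucc g := by
    rw [Derivation.leibniz, pderiv_X_of_ne hl.symm, smul_zero, add_zero, smul_eq_mul]
  have hmem : Fin.last n ∈ (univ.erase j.castSucc : Finset (Fin (n + 1))) :=
    mem_erase.2 ⟨hl.symm, mem_univ _⟩
  have hsum : ∑ q ∈ univ.erase j.castSucc,
      weight j.castSucc q * divDiff j.castSucc q (X (Fin.last n) * g) =
      X (Fin.last n) * ∑ q ∈ univ.erase j.castSucc,
        (if finRotate (n + 1) q < j.succ then X j.castSucc else X q) * divDiff j.castSucc q g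
      - X (Fin.last n) * g := by
    rw [mul_sum, ← add_sum_erase _ _ hmem, ← add_sum_erase _ _ hmem, add_sub_right_comm]
    congr 1
    · rw [weight, if_neg (Fin.castSucc_lt_last j).not_gt, finRotate_last,
        if_pos (Fin.succ_pos j), divDiff_X_mul_right hl]
      ring
    · refine sum_congr rfl fun q hq => ?_
      simp only [mem_erase, mem_univ, and_true] at hq
      rw [divDiff_X_mul_of_ne hq.2.symm hl.symm hq.1.symm, weight]
      obtain ⟨k, rfl⟩ := Fin.exists_castSucc_eq.2 hq.1
      rw [finRotate_castSucc]
      simp only [Fin.castSucc_lt_castSucc_iff, Fin.succ_lt_succ_iff]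
      ring
  rw [hp, hsum, mul_sub, mul_add, mul_smul_comm, mul_smul_comm, Fin.val_succ, Fin.val_castSucc,
    mul_left_comm (X j.castSucc)]
  push_cast
  module

/-- Differentiating the prefactor `z_N` gives the `α`; each of the `n` divided differences gives one
extra `z_N g`, cancelling the constant `-n`. -/
theorem xi_raiseOp_last {n : ℕ} (α : ℝ) (f : MvPolynomial (Fin (n + 1)) ℝ) :
    xi α (Fin.last n) (raiseOp f) = raiseOp (xi α 0 f) + α • raiseOp f := by
  rw [raiseOp, raiseOp, rename_xi, xi_eq, finRotate_symm_zero, Equiv.symm_symm]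
  set g := rename (finRotate (n + 1)).symm f
  have hp : pderiv (Fin.last n) (X (Fin.last n) * g) =
      X (Fin.last n) * pderiv (Fin.last n) g + g := by
    rw [Derivation.leibniz, pderiv_X_self, smul_eq_mul, smul_eq_mul, mul_one]
  have hsum : ∑ q ∈ univ.erase (Fin.last n),
      weight (Fin.last n) q * divDiff (Fin.last n) q (X (Fin.last n) * g) =
      X (Fin.last n) * ∑ q ∈ univ.erase (Fin.last n),
        (if finRotate (n + 1) q < 0 then X (Fin.last n) else X q) * divDiff (Fin.last n) q g
      + (n : ℝ) • (X (Fin.last n) * g) := by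
    have hc : (n : ℝ) • (X (Fin.last n) * g) =
        ∑ q ∈ univ.erase (Fin.last n), X (Fin.last n) * g := by
      rw [sum_const, card_erase_of_mem (mem_univ _), card_univ, Fintype.card_fin,
        Nat.add_sub_cancel, Nat.cast_smul_eq_nsmul]
    rw [hc, mul_sum, ← sum_add_distrib]
    refine sum_congr rfl fun q hq => ?_
    have hq := ne_of_mem_erase hq
    rw [weight, if_pos (Fin.lt_last_iff_ne_last.2 hq), if_neg (Fin.not_lt_zero _),
      divDiff_X_mul_left hq.symm]
    ring
  rw [hp, hsum, mul_sub, mul_add, mul_add, mul_smul_comm, mul_smul_comm, Fin.val_zero,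
    Fin.val_last, mul_left_comm (X (Fin.last n))]
  push_cast
  module

theorem raise_symm {n : ℕ} (η : Fin (n + 1) → ℕ) (j : Fin (n + 1)) :
    raise η ((finRotate (n + 1)).symm j) = η j + if j = 0 then 1 else 0 := by
  refine Fin.cases ?_ (fun k => ?_) j
  · rw [finRotate_symm_zero, raise, Fin.snoc_last, if_pos rfl]
  · rw [finRotate_symm_succ, raise, Fin.snoc_castSucc, if_neg (Fin.succ_ne_zero k), add_zero]

/-- The first row becomes the last, losing every tie, and its extra box makes up exactly for that.
-/
theorem precedes_raise {n : ℕ} (η : Fin (n + 1) → ℕ) (k j : Fin (n + 1)) :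
    Precedes (raise η) ((finRotate (n + 1)).symm k) ((finRotate (n + 1)).symm j) ↔
      Precedes η k j := by
  unfold Precedes
  rw [raise_symm, raise_symm]
  cases k using Fin.cases with
  | zero =>
    cases j using Fin.cases with
    | zero => simp
    | succ j =>
      rw [finRotate_symm_zero, finRotate_symm_succ, if_pos rfl, if_neg (Fin.succ_ne_zero j),
        Fin.lt_def, Fin.lt_def, Fin.val_last, Fin.val_castSucc, Fin.val_zero, Fin.val_succ]
      omega
  | succ k =>
    cases j using Fin.cases with
    | zero =>
      rw [finRotate_symm_zero, finRotate_symm_succ, if_pos rfl, if_neg (Fin.succ_ne_zero k),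
        Fin.lt_def, Fin.lt_def, Fin.val_last, Fin.val_castSucc, Fin.val_zero, Fin.val_succ]
      omega
    | succ j =>
      rw [finRotate_symm_succ, finRotate_symm_succ, if_neg (Fin.succ_ne_zero j),
        if_neg (Fin.succ_ne_zero k), Fin.castSucc_lt_castSucc_iff, Fin.succ_lt_succ_iff,
        add_zero, add_zero]

theorem eigenvalue_raise {n : ℕ} (α : ℝ) (η : Fin (n + 1) → ℕ) (j : Fin (n + 1)) :
    eigenvalue α (raise η) ((finRotate (n + 1)).symm j) =
      eigenvalue α η j + if j = 0 then α else 0 := by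
  have : colegLength (raise η) ((finRotate (n + 1)).symm j) = colegLength η j := by
    rw [colegLength_eq_card, colegLength_eq_card,
      ← card_map (s := univ.filter fun k => Precedes η k j) (finRotate (n + 1)).symm.toEmbedding]
    congr 1
    ext k
    obtain ⟨k, rfl⟩ := (finRotate (n + 1)).symm.surjective k
    simp only [mem_map_equiv, Equiv.symm_symm, Equiv.apply_symm_apply, mem_filter, mem_univ,
      true_and, precedes_raise]
  rw [eigenvalue, eigenvalue, this, raise_symm]
  push_cast
  split_ifs <;> ring

theorem coeffAt_raise {n : ℕ} (η : Fin (n + 1) → ℕ) (f : MvPolynomial (Fin (n + 1)) ℝ) :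
    coeffAt (raise η) (raiseOp f) = coeffAt η f := by
  have hk : Finsupp.equivFunOnFinite.symm (raise η) = Finsupp.single (Fin.last n) 1 +
      Finsupp.equivFunOnFinite.symm (η ∘ (finRotate (n + 1)).symm.symm) := by
    ext k
    obtain ⟨j, rfl⟩ := (finRotate (n + 1)).symm.surjective k
    have : Fin.last n = (finRotate (n + 1)).symm j ↔ j = 0 := by
      rw [← finRotate_symm_zero, EmbeddingLike.apply_eq_iff_eq, eq_comm]
    rw [Finsupp.add_apply, Finsupp.single_apply, Finsupp.equivFunOnFinite_symm_apply_apply,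
      Finsupp.equivFunOnFinite_symm_apply_apply, raise_symm, Function.comp_apply,
      Equiv.symm_apply_apply, add_comm]
    simp only [this]
  rw [raiseOp, coeffAt_apply, hk, coeff_X_mul, ← coeffAt_apply, coeffAt_rename]

theorem exists_isNonsymmJack_raise {n : ℕ} {α : ℝ} {η : Fin (n + 1) → ℕ}
    (h : ∃ P, IsNonsymmJack α η P) : ∃ P, IsNonsymmJack α (raise η) P := by
  obtain ⟨P, hP, hc⟩ := h
  refine ⟨raiseOp P, isNonsymmJack_iff.2 ⟨fun j => ?_, by rw [coeffAt_raise]; exact hc⟩⟩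
  have hsmul : ∀ c : ℝ, raiseOp (c • P) = c • raiseOp P := fun c => by
    rw [raiseOp, map_smul, mul_smul_comm, raiseOp]
  obtain ⟨k, rfl⟩ := (finRotate (n + 1)).symm.surjective j
  rw [eigenvalue_raise]
  cases k using Fin.cases with
  | zero =>
    rw [finRotate_symm_zero, xi_raiseOp_last, hP, hsmul, if_pos rfl, add_smul]
  | succ k =>
    rw [finRotate_symm_succ, xi_raiseOp_castSucc, hP, hsmul, if_neg (Fin.succ_ne_zero k),
      add_zero]

/-! ### Existence -/

theorem isNonsymmJack_zero (α : ℝ) : IsNonsymmJack α (0 : Fin N → ℕ) 1 := by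
  have h1 : mono (0 : Fin N → ℕ) = 1 := by simp [mono_eq_prod]
  refine isNonsymmJack_iff.2 ⟨fun i => ?_, by rw [← h1, coeffAt_mono, if_pos rfl]⟩
  have := xi_mono_sub_mem α (0 : Fin N → ℕ) i
  have hbot : lowerSpan (0 : Fin N → ℕ) = ⊥ := by
    rw [lowerSpan, Submodule.span_eq_bot]
    rintro _ ⟨μ, hμ, rfl⟩
    exfalso
    have h0 := excess_le_of_key_le (le_of_lt (show key μ < key 0 from hμ)) 0
    have h2 : μ = 0 := by
      rw [excess_zero, excess_zero] at h0
      simpa [Finset.sum_eq_zero_iff, funext_iff] using h0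
    rw [h2] at hμ
    exact lt_irrefl (key (0 : Fin N → ℕ)) hμ
  rwa [hbot, Submodule.mem_bot, sub_eq_zero, h1] at this

/-- Induction on the modulus and, inside it, along `key`. A nonzero last part means `η` is raised
from a smaller modulus; otherwise `η` is zero or has an adjacent descent, whose swap is lower in
`key`. -/
theorem exists_isNonsymmJack {α : ℝ} (hα : 0 < α) (η : Fin N → ℕ) :
    ∃ P, IsNonsymmJack α η P := by
  rcases N with _ | n
  · rw [Subsingleton.elim η 0]
    exact ⟨1, isNonsymmJack_zero α⟩
  induction hm : ∑ i, η i using Nat.strong_induction_on generalizing η with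
  | _ m ih =>
    induction η using key_induction with
    | h η ihη =>
      by_cases hlast : η (Fin.last n) = 0
      · by_cases hmon : Monotone η
        · have : η = 0 := funext fun i => Nat.le_zero.1 (hlast ▸ hmon (Fin.le_last i))
          exact this ▸ ⟨1, isNonsymmJack_zero α⟩
        · rw [Fin.monotone_iff_le_succ] at hmon
          push Not at hmon
          obtain ⟨i, hi⟩ := hmon
          have hswap : (η ∘ Equiv.swap i.castSucc i.succ) ∘ Equiv.swap i.castSucc i.succ = η := by
            rw [Function.comp_assoc, ← Equiv.coe_trans, Equiv.swap_swap]
            rfl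
          rw [← hswap]
          refine exists_isNonsymmJack_comp_swap hα (by simp) (by simpa using hi)
            (ihη _ (key_comp_swap_lt (Fin.castSucc_lt_succ) hi) ?_)
          rw [← hm]
          exact Equiv.sum_comp _ η
      · set μ : Fin (n + 1) → ℕ := Fin.cons (η (Fin.last n) - 1) fun j => η j.castSucc with hμ
        have hr : raise μ = η := by
          funext j
          refine Fin.lastCases ?_ (fun k => ?_) j
          · rw [raise, Fin.snoc_last, hμ, Fin.cons_zero]
            omega
          · rw [raise, Fin.snoc_castSucc, hμ, Fin.cons_succ]
        rw [← hr]
        refine exists_isNonsymmJack_raise (ih _ ?_ μ rfl)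
        rw [← hm, Fin.sum_univ_succ, Fin.sum_univ_castSucc, hμ, Fin.cons_zero]
        simp only [Fin.cons_succ]
        omega

theorem isNonsymmJack_nonsymmJack {α : ℝ} (hα : 0 < α) (η : Fin N → ℕ) :
    IsNonsymmJack α η (nonsymmJack α η) :=
  Classical.epsilon_spec (exists_isNonsymmJack hα η)

theorem isNonsymmJack_iff_eq {α : ℝ} (hα : 0 < α) (η : Fin N → ℕ)
    (P : MvPolynomial (Fin N) ℝ) : IsNonsymmJack α η P ↔ P = nonsymmJack α η :=
  ⟨fun h => h.unique hα (isNonsymmJack_nonsymmJack hα η),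
    fun h => h ▸ isNonsymmJack_nonsymmJack hα η⟩

theorem coeffAt_nonsymmJack_self {α : ℝ} (hα : 0 < α) (η : Fin N → ℕ) :
    coeffAt η (nonsymmJack α η) = 1 := (isNonsymmJack_nonsymmJack hα η).2

theorem key_le_of_coeffAt_nonsymmJack_ne_zero {α : ℝ} (hα : 0 < α) {κ η : Fin N → ℕ}
    (h : coeffAt κ (nonsymmJack α η) ≠ 0) : key κ ≤ key η :=
  IsEigen.key_le hα (isNonsymmJack_nonsymmJack hα η).1 h

/-! ### Expansions in non-symmetric Jack polynomials -/

/-- At an index with no index of the expansion above it, only its own polynomial contributes, with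
leading coefficient one. -/
theorem coeffAt_sum_nonsymmJack {α : ℝ} (hα : 0 < α) {A : (Fin N → ℕ) →₀ ℝ} {κ : Fin N → ℕ}
    (h : ∀ m, A m ≠ 0 → ¬ key κ < key m) :
    coeffAt κ (A.sum fun ν c => c • nonsymmJack α ν) = A κ := by
  have hz : ∀ m ≠ κ, A m * coeffAt κ (nonsymmJack α m) = 0 := by
    intro m hm
    by_contra h0
    have hle := key_le_of_coeffAt_nonsymmJack_ne_zero hα (right_ne_zero_of_mul h0)
    exact h m (left_ne_zero_of_mul h0) (hle.lt_of_ne (key_injective.ne hm.symm))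
  rw [Finsupp.sum, map_sum]
  simp only [map_smul, smul_eq_mul]
  rw [sum_eq_single κ (fun m _ hm => hz m hm), coeffAt_nonsymmJack_self hα, mul_one]
  intro hκ
  rw [Finsupp.notMem_support_iff.1 hκ, zero_mul]

theorem nonsymmJack_expansion_unique {α : ℝ} (hα : 0 < α) {A B : (Fin N → ℕ) →₀ ℝ}
    (h : (A.sum fun ν c => c • nonsymmJack α ν) = B.sum fun ν c => c • nonsymmJack α ν) :
    A = B := by
  have hz : ((A - B).sum fun ν c => c • nonsymmJack α ν) = 0 := by
    rw [Finsupp.sum_sub_index fun _ _ _ => sub_smul _ _ _, h, sub_self]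
  rw [← sub_eq_zero]
  ext κ
  by_contra hκ
  obtain ⟨m, -, hm, hmax⟩ := exists_maximal_of_ne_zero (c := ⇑(A - B))
    (A - B).hasFiniteSupport hκ
  refine hm ?_
  rw [← coeffAt_sum_nonsymmJack hα hmax, hz, map_zero]

theorem mono_mem_span_nonsymmJack {α : ℝ} (hα : 0 < α) (η : Fin N → ℕ) :
    mono η ∈ Submodule.span ℝ (Set.range (nonsymmJack (N := N) α)) := by
  induction η using key_induction with
  | h η ih =>
    have hE := eq_sum_mono (nonsymmJack α η)
    have hmem : Finsupp.equivFunOnFinite.symm η ∈ (nonsymmJack α η).support := by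
      rw [mem_support_iff, ← coeffAt_apply, coeffAt_nonsymmJack_self hα]
      exact one_ne_zero
    rw [← add_sum_erase _ _ hmem] at hE
    simp only [Finsupp.coe_equivFunOnFinite_symm, coeffAt_nonsymmJack_self hα, one_smul] at hE
    rw [eq_comm, ← eq_sub_iff_add_eq] at hE
    rw [hE]
    refine Submodule.sub_mem _ (Submodule.subset_span ⟨η, rfl⟩)
      (Submodule.sum_mem _ fun m hm => Submodule.smul_mem _ _ (ih _ ?_))
    rw [mem_erase, mem_support_iff] at hm
    refine (key_le_of_coeffAt_nonsymmJack_ne_zero hα (κ := m) ?_).lt_of_ne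
      (key_injective.ne fun h => hm.1 ?_)
    · rw [coeffAt_apply, Finsupp.equivFunOnFinite_symm_coe]
      exact hm.2
    · rw [← h, Finsupp.equivFunOnFinite_symm_coe]

theorem exists_nonsymmJack_expansion {α : ℝ} (hα : 0 < α) (f : MvPolynomial (Fin N) ℝ) :
    ∃ A : (Fin N → ℕ) →₀ ℝ, f = A.sum fun ν c => c • nonsymmJack α ν := by
  have : f ∈ Submodule.span ℝ (Set.range (nonsymmJack (N := N) α)) := by
    rw [eq_sum_mono f]
    exact Submodule.sum_mem _ fun m _ => Submodule.smul_mem _ _ (mono_mem_span_nonsymmJack hα _)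
  obtain ⟨A, hA⟩ := Finsupp.mem_span_range_iff_exists_finsupp.1 this
  exact ⟨A, hA.symm⟩

theorem isPieriExpansion_pieriCoeff {α : ℝ} (hα : 0 < α) (p : ℕ) (η : Fin N → ℕ) :
    IsPieriExpansion α p η (pieriCoeff α p η) :=
  Classical.epsilon_spec (exists_nonsymmJack_expansion hα _)

theorem isPieriExpansion_iff {α : ℝ} (hα : 0 < α) (p : ℕ) (η : Fin N → ℕ)
    (A : (Fin N → ℕ) →₀ ℝ) : IsPieriExpansion α p η A ↔ A = pieriCoeff α p η :=
  ⟨fun h => nonsymmJack_expansion_unique hα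
      (h.symm.trans (isPieriExpansion_pieriCoeff hα p η)),
    fun h => h ▸ isPieriExpansion_pieriCoeff hα p η⟩

/-! ### The leading coefficient of `e_p E_η` -/

theorem esymm_eq_sum_mono (p : ℕ) :
    esymm (Fin N) ℝ p = ∑ M ∈ powersetCard p univ, mono (addBoxes (0 : Fin N → ℕ) M) := by
  rw [esymm]
  refine sum_congr rfl fun M _ => ?_
  rw [mono_eq_prod]
  simp [addBoxes, prod_ite_mem, pow_ite]

theorem coeffAt_esymm_mul (p : ℕ) (κ : Fin N → ℕ) (f : MvPolynomial (Fin N) ℝ) :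
    coeffAt κ (esymm (Fin N) ℝ p * f) = ∑ M ∈ powersetCard p univ, ∑ m ∈ f.support,
      if addBoxes (m : Fin N → ℕ) M = κ then coeffAt (m : Fin N → ℕ) f else 0 := by
  conv_lhs => rw [eq_sum_mono f, esymm_eq_sum_mono, sum_mul_sum]
  simp only [map_sum, mul_smul_comm, mono_mul_mono, map_smul, coeffAt_mono, smul_eq_mul,
    mul_ite, mul_one, mul_zero]
  refine sum_congr rfl fun M _ => sum_congr rfl fun m _ => ?_
  have : addBoxes 0 M + (m : Fin N → ℕ) = addBoxes m M := by
    funext i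
    simp [addBoxes, add_comm]
  rw [this]

/-- Any other choice of a monomial of `e_p` and one of `E_η` has an exponent strictly below
`topBoxes p η`, so a single product remains. -/
theorem coeffAt_topBoxes_esymm_mul {α : ℝ} (hα : 0 < α) {p : ℕ} (hp : p ≤ N) (η : Fin N → ℕ) :
    coeffAt (topBoxes p η) (esymm (Fin N) ℝ p * nonsymmJack α η) = 1 := by
  have hmem : Finsupp.equivFunOnFinite.symm η ∈ (nonsymmJack α η).support := by
    rw [mem_support_iff, ← coeffAt_apply, coeffAt_nonsymmJack_self hα]
    exact one_ne_zero
  have hm : ∀ m ∈ (nonsymmJack α η).support, (m : Fin N → ℕ) ≠ η → key (m : Fin N → ℕ) < key η := by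
    intro m hm hne
    refine (key_le_of_coeffAt_nonsymmJack_ne_zero hα (κ := m) ?_).lt_of_ne (key_injective.ne hne)
    rw [coeffAt_apply, Finsupp.equivFunOnFinite_symm_coe]
    exact mem_support_iff.1 hm
  rw [coeffAt_esymm_mul, sum_eq_single (G1 p η)]
  · rw [sum_eq_single (Finsupp.equivFunOnFinite.symm η)]
    · simp only [Finsupp.coe_equivFunOnFinite_symm]
      rw [if_true, coeffAt_nonsymmJack_self hα]
    · intro m hms hne
      rw [if_neg]
      intro h
      refine (key_addBoxes_lt_topBoxes_of_key_lt hp (hm m hms ?_) (card_G1 hp η)).ne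
        (congrArg key h)
      rintro h'
      exact hne (by rw [← h', Finsupp.equivFunOnFinite_symm_coe])
    · exact fun h => absurd hmem h
  · intro M hM hne
    refine sum_eq_zero fun m hms => if_neg fun h => ?_
    rw [mem_powersetCard_univ] at hM
    by_cases hmη : (m : Fin N → ℕ) = η
    · rw [hmη] at h
      exact hne (addBoxes_injective η h)
    · exact (key_addBoxes_lt_topBoxes_of_key_lt hp (hm m hms hmη) hM).ne (congrArg key h)
  · intro h
    exact absurd (mem_powersetCard_univ.2 (card_G1 hp η)) h

theorem key_le_of_coeffAt_esymm_mul_ne_zero {α : ℝ} (hα : 0 < α) {p : ℕ} (hp : p ≤ N)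
    {η κ : Fin N → ℕ} (h : coeffAt κ (esymm (Fin N) ℝ p * nonsymmJack α η) ≠ 0) :
    key κ ≤ key (topBoxes p η) := by
  rw [coeffAt_esymm_mul] at h
  obtain ⟨M, hM, h⟩ := exists_ne_zero_of_sum_ne_zero h
  obtain ⟨m, -, h⟩ := exists_ne_zero_of_sum_ne_zero h
  rw [mem_powersetCard_univ] at hM
  obtain ⟨hκ, hc⟩ := ite_ne_right_iff.1 h
  subst hκ
  rcases (key_le_of_coeffAt_nonsymmJack_ne_zero hα hc).lt_or_eq with hlt | heq
  · exact (key_addBoxes_lt_topBoxes_of_key_lt hp hlt hM).le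
  · rw [key_injective heq]
    by_cases hM' : M = G1 p η
    · rw [hM']
    · exact (key_addBoxes_lt_topBoxes hp hM hM').le

theorem pieriCoeff_topBoxes {α : ℝ} (hα : 0 < α) {p : ℕ} (hp : p ≤ N) (η : Fin N → ℕ) :
    pieriCoeff α p η (topBoxes p η) = 1 := by
  have hA := isPieriExpansion_pieriCoeff hα p η
  rw [IsPieriExpansion] at hA
  rw [← coeffAt_topBoxes_esymm_mul hα hp η, hA, coeffAt_sum_nonsymmJack hα]
  intro m hm hlt
  -- An index above `ν` would lie below a maximal one, whose coefficient is visible in `e_p E_η` as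
  -- that of a monomial above `ν`.
  obtain ⟨κ, hle, hκ, hmax⟩ := exists_maximal_of_ne_zero (c := ⇑(pieriCoeff α p η))
    (pieriCoeff α p η).hasFiniteSupport hm
  refine (hlt.trans_le hle).not_ge (key_le_of_coeffAt_esymm_mul_ne_zero hα hp (α := α) ?_)
  rwa [hA, coeffAt_sum_nonsymmJack hα hmax]

end

/-! ### Gamma-function form of `d'` and `e'`, and the product formula. -/

section

open Finset

/-! ### Products of linear factors as quotients of Gamma functions -/

theorem prod_Ico_mul_add {α : ℝ} (hα : 0 < α) {u : ℝ} (hu : 0 ≤ u) {a b : ℕ} (ha : 1 ≤ a)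
    (hab : a ≤ b) : ∏ x ∈ Ico a b, (α * x + u) =
      α ^ (b - a) * (Real.Gamma (b + u / α) / Real.Gamma (a + u / α)) := by
  have hpos : ∀ n : ℕ, 1 ≤ n → 0 < (n : ℝ) + u / α := fun n hn => by
    have : (0 : ℝ) < n := by exact_mod_cast hn
    positivity
  induction b, hab using Nat.le_induction with
  | base => simp [(Real.Gamma_pos_of_pos (hpos a ha)).ne']
  | succ b hab ih =>
    have hb := hpos b (ha.trans hab)
    have hg : Real.Gamma ((b + 1 : ℕ) + u / α) = (b + u / α) * Real.Gamma (b + u / α) := by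
      rw [← Real.Gamma_add_one hb.ne']
      congr 1
      push_cast
      ring
    rw [prod_Ico_succ_top hab, ih, hg, Nat.succ_sub hab, pow_succ]
    field_simp

/-- The product of the linear factors `α x + l(x)`, where `l` is a step function with steps at
the points `a_s`. -/
theorem prod_mul_add_card_filter {ι : Type*} [LinearOrder ι] {α : ℝ} (hα : 0 < α) (n : ℕ)
    (T : Finset ι) (a : ι → ℕ) (hmono : MonotoneOn a T) (h₁ : ∀ s ∈ T, 1 ≤ a s)
    (h₂ : ∀ s ∈ T, a s ≤ n + 1) :
    ∏ x ∈ Ico 1 (n + 1), (α * x + ((T.filter fun s => a s ≤ x).card : ℝ)) =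
      α ^ n * (Real.Gamma (n + 1 + T.card / α) *
        ∏ s ∈ T, Real.Gamma (a s + ((T.filter fun t => t < s).card : ℝ) / α) /
          Real.Gamma (a s + (((T.filter fun t => t < s).card : ℝ) + 1) / α)) := by
  induction T using Finset.induction_on_max with
  | empty =>
    have := prod_Ico_mul_add hα le_rfl le_rfl (Nat.le_add_left 1 n)
    simpa using this
  | insert M T hM ih =>
    have hMT : M ∉ T := fun h => lt_irrefl _ (hM M h)
    have ih := ih (hmono.mono (by simp)) (fun s hs => h₁ s (mem_insert_of_mem hs))
      fun s hs => h₂ s (mem_insert_of_mem hs)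
    have hA₁ := h₁ M (mem_insert_self _ _)
    have hA₂ := h₂ M (mem_insert_self _ _)
    have hle : ∀ s ∈ T, a s ≤ a M := fun s hs =>
      hmono (by simp [hs]) (by simp) (hM s hs).le
    -- Both products are split at `a M`: from there on every step is counted, and before it the new
    -- step is invisible.
    have hT : ∀ x ∈ Ico (a M) (n + 1),
        α * x + ((T.filter fun s => a s ≤ x).card : ℝ) = α * x + (T.card : ℝ) := by
      intro x hx
      rw [filter_true_of_mem fun s hs => (hle s hs).trans (mem_Ico.1 hx).1]
    have hI : ∀ x ∈ Ico (a M) (n + 1),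
        α * x + (((insert M T).filter fun s => a s ≤ x).card : ℝ) =
          α * x + ((T.card : ℝ) + 1) := by
      intro x hx
      rw [filter_insert, if_pos (mem_Ico.1 hx).1, card_insert_of_notMem (by simp [hMT]),
        filter_true_of_mem fun s hs => (hle s hs).trans (mem_Ico.1 hx).1]
      push_cast
      rfl
    have hI' : ∀ x ∈ Ico 1 (a M),
        α * x + (((insert M T).filter fun s => a s ≤ x).card : ℝ) =
          α * x + ((T.filter fun s => a s ≤ x).card : ℝ) := by
      intro x hx
      rw [filter_insert, if_neg (mem_Ico.1 hx).2.not_ge]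
    have hcM : (insert M T).filter (fun t => t < M) = T := by
      rw [filter_insert, if_neg (lt_irrefl M), filter_true_of_mem hM]
    have hcT : ∀ s ∈ T, (insert M T).filter (fun t => t < s) = T.filter fun t => t < s := by
      intro s hs
      rw [filter_insert, if_neg (hM s hs).not_gt]
    rw [← prod_Ico_consecutive _ hA₁ hA₂, prod_congr rfl hT,
      prod_Ico_mul_add hα (by positivity) hA₁ hA₂] at ih
    rw [← prod_Ico_consecutive _ hA₁ hA₂, prod_congr rfl hI, prod_congr rfl hI',
      prod_Ico_mul_add hα (by positivity) hA₁ hA₂, prod_insert hMT, hcM,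
      prod_congr (s₁ := T) rfl fun s hs => by rw [hcT s hs], card_insert_of_notMem hMT]
    have hA₀ : (0 : ℝ) < a M := by exact_mod_cast hA₁
    have g₁ : Real.Gamma (a M + (T.card : ℝ) / α) ≠ 0 :=
      (Real.Gamma_pos_of_pos (by positivity)).ne'
    have g₂ : Real.Gamma (n + 1 + (T.card : ℝ) / α) ≠ 0 :=
      (Real.Gamma_pos_of_pos (by positivity)).ne'
    push_cast at ih ⊢
    set R := ∏ s ∈ T, Real.Gamma (a s + ((T.filter fun t => t < s).card : ℝ) / α) /
          Real.Gamma (a s + (((T.filter fun t => t < s).card : ℝ) + 1) / α)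
    set L := ∏ x ∈ Ico 1 (a M), (α * x + ((T.filter fun s => a s ≤ x).card : ℝ))
    have ih' : L * α ^ (n + 1 - a M) = α ^ n * R * Real.Gamma (a M + (T.card : ℝ) / α) := by
      generalize Real.Gamma (a M + (T.card : ℝ) / α) = u at *
      generalize Real.Gamma (n + 1 + (T.card : ℝ) / α) = v at *
      field_simp at ih
      linear_combination ih
    rw [← mul_assoc, ih']
    ring

/-! ### The constants `d'` and `e'` -/

/-- The argument of the Gamma functions attached to a pair of rows. -/
noncomputable def pairArg (α : ℝ) (η : Fin N → ℕ) (i k : Fin N) : ℝ :=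
  (eigenvalue α η i - eigenvalue α η k) / α + if i < k then 1 else 0

/-- The contribution of a pair of rows to `d'_η`. -/
noncomputable def pairFactor (α : ℝ) (η : Fin N → ℕ) (i k : Fin N) : ℝ :=
  Real.Gamma (pairArg α η i k - 1 / α) / Real.Gamma (pairArg α η i k)

/-- Keeps all Gamma arguments in the positive range, so that the Gamma values are nonzero and the
functional equation applies. -/
theorem Precedes.one_le_pairArg {α : ℝ} (hα : 0 < α) {η : Fin N → ℕ} {i k : Fin N}
    (h : Precedes η i k) : 1 ≤ pairArg α η i k - 1 / α := by
  have h₁ : (colegLength η i : ℝ) + 1 ≤ colegLength η k := by exact_mod_cast h.colegLength_lt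
  have h₂ : (1 : ℝ) ≤ η i - η k + if i < k then 1 else 0 := by
    rcases h with h | ⟨h, h'⟩
    · have : (η k : ℝ) + 1 ≤ η i := by exact_mod_cast h
      split_ifs <;> linarith
    · rw [if_pos h', h]
      linarith
  have h₃ : pairArg α η i k - 1 / α = (η i - η k + if i < k then 1 else 0) +
      ((colegLength η k : ℝ) - colegLength η i - 1) / α := by
    simp only [pairArg, eigenvalue]
    field_simp
    ring
  have h₄ : 0 ≤ ((colegLength η k : ℝ) - colegLength η i - 1) / α :=
    div_nonneg (by linarith) hα.le
  linarith

theorem Precedes.pairFactor_pos {α : ℝ} (hα : 0 < α) {η : Fin N → ℕ} {i k : Fin N}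
    (h : Precedes η i k) : 0 < pairFactor α η i k := by
  have h₁ := h.one_le_pairArg hα
  have h₂ : 0 < 1 / α := by positivity
  exact div_pos (Real.Gamma_pos_of_pos (by linarith)) (Real.Gamma_pos_of_pos (by linarith))

/-- The distance at which row `k` starts to contribute to the leg lengths of row `i`. -/
def legStep (η : Fin N → ℕ) (i k : Fin N) : ℕ := (η i - η k) + if i < k then 1 else 0

/-- Only rows later in sorted order contribute to a leg, each from a fixed distance from the row's
end; the leg is thus a step function of `η_i + 1 - j`. -/
theorem leg_eq_card (η : Fin N → ℕ) (r : Fin N) {j : ℕ} (hj : j ≤ η (sortPerm η r)) :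
    leg η (sortPerm η r) j = ((Ioi r).filter fun s =>
      legStep η (sortPerm η r) (sortPerm η s) ≤ η (sortPerm η r) + 1 - j).card := by
  rw [leg, ← card_union_of_disjoint, ← card_map (s := filter _ (Ioi r)) (sortPerm η).toEmbedding]
  · congr 1
    ext k
    obtain ⟨s, rfl⟩ := (sortPerm η).surjective k
    simp only [mem_map_equiv, Equiv.symm_apply_apply, mem_union, mem_filter, mem_univ, true_and,
      mem_Ioi, ← precedes_sortPerm_iff η (r := r) (s := s)]
    unfold Precedes legStep
    generalize sortPerm η r = i at *
    generalize sortPerm η s = k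
    rcases lt_trichotomy i k with h | rfl | h
    · rw [if_pos h]; omega
    · simp
    · rw [if_neg h.not_gt]; omega
  · rw [disjoint_filter]
    intro k _ h₁ h₂
    exact absurd h₁.1 h₂.1.not_gt

theorem prod_row (α : ℝ) (hα : 0 < α) (η : Fin N → ℕ) (r : Fin N) :
    ∏ j ∈ Icc 1 (η (sortPerm η r)),
      (α * (((η (sortPerm η r) : ℝ) - (j : ℝ)) + 1) + (leg η (sortPerm η r) j : ℝ)) =
    α ^ η (sortPerm η r) *
      (Real.Gamma (1 + ((N : ℝ) - 1) / α - (r : ℝ) / α + η (sortPerm η r)) *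
        ∏ k ∈ univ.filter (Precedes η (sortPerm η r)), pairFactor α η (sortPerm η r) k) := by
  have hprec : ∀ s ∈ Ioi r, Precedes η (sortPerm η r) (sortPerm η s) := fun s hs =>
    (precedes_sortPerm_iff η).2 (mem_Ioi.1 hs)
  have hmono : MonotoneOn (fun s => legStep η (sortPerm η r) (sortPerm η s)) (Ioi r) := by
    intro s hs t ht hst
    have h₁ := hprec s hs
    have h₂ := hprec t ht
    have h₃ : s = t ∨ Precedes η (sortPerm η s) (sortPerm η t) :=
      hst.eq_or_lt.imp_right (precedes_sortPerm_iff η).2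
    rcases h₃ with rfl | h₃
    · exact le_rfl
    simp only [legStep]
    unfold Precedes at h₁ h₂ h₃
    split_ifs <;> omega
  have hcard : (Ioi r).card = N - 1 - r := Fin.card_Ioi r
  have hr := r.isLt
  have key := prod_mul_add_card_filter hα (η (sortPerm η r)) (Ioi r)
    (fun s => legStep η (sortPerm η r) (sortPerm η s)) hmono
    (fun s hs => by
      have := hprec s hs
      unfold Precedes at this
      simp only [legStep]
      split_ifs <;> omega)
    (fun s hs => by
      simp only [legStep]
      split_ifs <;> omega)
  have hfilter : univ.filter (Precedes η (sortPerm η r)) =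
      (Ioi r).map (sortPerm η).toEmbedding := by
    ext k
    obtain ⟨s, rfl⟩ := (sortPerm η).surjective k
    simp [precedes_sortPerm_iff]
  rw [hfilter, prod_map]
  calc _ = _ := ?_
    _ = _ := key
    _ = _ := ?_
  -- Columns are counted from the right end, so that the arm length plus one is the variable.
  · refine prod_nbij' (fun j => η (sortPerm η r) + 1 - j) (fun x => η (sortPerm η r) + 1 - x)
      ?_ ?_ ?_ ?_ ?_
    · intro j hj
      rw [mem_Icc] at hj
      rw [mem_Ico]
      omega
    · intro j hj
      rw [mem_Ico] at hj
      rw [mem_Icc]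
      omega
    · intro j hj
      rw [mem_Icc] at hj
      omega
    · intro j hj
      rw [mem_Ico] at hj
      omega
    · intro j hj
      rw [mem_Icc] at hj
      rw [leg_eq_card η r hj.2, Nat.cast_sub (by omega)]
      push_cast
      ring
  · congr 2
    · congr 1
      rw [hcard, Nat.cast_sub (by omega), Nat.cast_sub (by omega)]
      push_cast
      ring
    · refine prod_congr rfl fun s hs => ?_
      have hrs := mem_Ioi.1 hs
      -- The positions `r` and `s` are the values of `l'`, so these counts turn the two Gamma
      -- arguments into `pairArg - 1 / α` and `pairArg`.
      have hc : ((Ioi r).filter fun t => t < s).card = s - r - 1 := by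
        rw [← Fin.card_Ioo]
        congr 1
        ext t
        simp
      have hle : η (sortPerm η s) ≤ η (sortPerm η r) := by
        have := hprec s hs
        unfold Precedes at this
        omega
      have hrs' : (r : ℕ) < s := hrs
      have harg : pairArg α η (sortPerm η r) (sortPerm η s) =
          legStep η (sortPerm η r) (sortPerm η s) + ((s : ℝ) - r) / α := by
        simp only [pairArg, eigenvalue, colegLength_sortPerm, legStep]
        push_cast [Nat.cast_sub hle]
        field_simp
        ring
      rw [hc, Equiv.coe_toEmbedding, pairFactor, harg, Nat.cast_sub (by omega),
        Nat.cast_sub (by omega)]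
      congr 2
      · push_cast
        ring
      · push_cast
        ring

theorem Gamma_base_pos {α : ℝ} (hα : 0 < α) (j : Fin N) (x : ℕ) :
    0 < Real.Gamma (1 + ((N : ℝ) - 1) / α - (j : ℝ) / α + x) := by
  refine Real.Gamma_pos_of_pos ?_
  have h₁ : (j : ℝ) + 1 ≤ N := by exact_mod_cast j.isLt
  have h₂ : 0 ≤ ((N : ℝ) - 1 - j) / α := div_nonneg (by linarith) hα.le
  have h₃ : 1 + ((N : ℝ) - 1) / α - (j : ℝ) / α + x = 1 + ((N : ℝ) - 1 - j) / α + x := by ring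
  rw [h₃]
  positivity

theorem ePrime_pos {α : ℝ} (hα : 0 < α) (η : Fin N → ℕ) : 0 < ePrime α η := by
  refine mul_pos (pow_pos hα _) (prod_pos fun j _ => div_pos (Gamma_base_pos hα j _) ?_)
  simpa using Gamma_base_pos hα j 0

theorem dPrime_pos {α : ℝ} (hα : 0 < α) (η : Fin N → ℕ) : 0 < dPrime α η := by
  refine prod_pos fun i _ => prod_pos fun j hj => ?_
  have : (j : ℝ) ≤ η i := by exact_mod_cast (mem_Icc.1 hj).2
  exact add_pos_of_pos_of_nonneg (mul_pos hα (by linarith)) (Nat.cast_nonneg _)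

/-- The `N - 1 - r` rows after position `r` make the numerator Gamma of each row the one occurring
in `e'`; the middle product does not depend on `η` and cancels in the ratio for `ν` and `η`. -/
theorem dPrime_eq {α : ℝ} (hα : 0 < α) (η : Fin N → ℕ) :
    dPrime α η = ePrime α η * (∏ j : Fin N, Real.Gamma (1 + ((N : ℝ) - 1) / α - (j : ℝ) / α)) *
      ∏ i, ∏ k ∈ univ.filter (Precedes η i), pairFactor α η i k := by
  have hg : ∀ j : Fin N, Real.Gamma (1 + ((N : ℝ) - 1) / α - (j : ℝ) / α) ≠ 0 := fun j => by
    simpa using (Gamma_base_pos hα j 0).ne'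
  rw [dPrime, ← Equiv.prod_comp (sortPerm η), prod_congr rfl fun r _ => prod_row α hα η r,
    prod_mul_distrib, prod_mul_distrib, prod_pow_eq_pow_sum, Equiv.sum_comp (sortPerm η) η,
    Equiv.prod_comp (sortPerm η) fun i => ∏ k ∈ univ.filter (Precedes η i), pairFactor α η i k,
    ePrime, genFactorial, prod_div_distrib, mul_assoc (α ^ _),
    div_mul_cancel₀ _ (prod_ne_zero_iff.2 fun j _ => hg j), mul_assoc]
  rfl

/-! ### The product formula -/

theorem eigenvalue_topBoxes (α : ℝ) (p : ℕ) (η : Fin N → ℕ) (i : Fin N) :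
    eigenvalue α (topBoxes p η) i = eigenvalue α η i + if i ∈ G1 p η then α else 0 := by
  simp only [eigenvalue, colegLength_topBoxes, addBoxes]
  split_ifs <;> push_cast <;> ring

theorem not_mem_G1_iff {p : ℕ} {η : Fin N → ℕ} {i : Fin N} : i ∉ G1 p η ↔ i ∈ G0 p η := by
  rw [mem_G1, mem_G0, not_lt]

theorem precedes_of_mem_G1_of_mem_G0 {p : ℕ} {η : Fin N → ℕ} {i k : Fin N} (hi : i ∈ G1 p η)
    (hk : k ∈ G0 p η) : Precedes η i k :=
  colegLength_lt_iff.1 ((mem_G1.1 hi).trans_le (mem_G0.1 hk))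

theorem pairFactor_topBoxes {α : ℝ} (hα : 0 < α) (p : ℕ) {η : Fin N → ℕ} {i k : Fin N}
    (h : Precedes η i k) : pairFactor α (topBoxes p η) i k = pairFactor α η i k *
      if i ∈ G1 p η ∧ k ∈ G0 p η then (pairArg α η i k - 1 / α) / pairArg α η i k else 1 := by
  have h₁ := h.one_le_pairArg hα
  have h₂ : 0 < 1 / α := by positivity
  by_cases hi : i ∈ G1 p η <;> by_cases hk : k ∈ G1 p η
  · have : pairArg α (topBoxes p η) i k = pairArg α η i k := by
      simp only [pairArg, eigenvalue_topBoxes, if_pos hi, if_pos hk]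
      ring
    rw [pairFactor, this, if_neg fun h' => not_mem_G1_iff.2 h'.2 hk, mul_one, pairFactor]
  · have : pairArg α (topBoxes p η) i k = pairArg α η i k + 1 := by
      simp only [pairArg, eigenvalue_topBoxes, if_pos hi, if_neg hk]
      field_simp
      ring
    rw [pairFactor, this, if_pos ⟨hi, not_mem_G1_iff.1 hk⟩, pairFactor, add_sub_right_comm,
      Real.Gamma_add_one (by linarith), Real.Gamma_add_one (by linarith), mul_div_mul_comm,
      mul_comm]
  -- Impossible: `G1` is an initial segment and row `i` comes before row `k`.
  · rw [mem_G1] at hi hk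
    have := h.colegLength_lt
    omega
  · have : pairArg α (topBoxes p η) i k = pairArg α η i k := by
      simp only [pairArg, eigenvalue_topBoxes, if_neg hi, if_neg hk, add_zero]
    rw [pairFactor, this, if_neg fun h' => hi h'.1, mul_one, pairFactor]

theorem pairArg_sub_div {α : ℝ} (hα : 0 < α) (η : Fin N → ℕ) (i k : Fin N) :
    (pairArg α η i k - 1 / α) / pairArg α η i k =
      (eigenvalue α η i - eigenvalue α η k + (if i < k then α else 0) - 1) /
        (eigenvalue α η i - eigenvalue α η k + if i < k then α else 0) := by
  rw [← mul_div_mul_left _ (pairArg α η i k) hα.ne']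
  congr 1 <;> simp only [pairArg] <;> split_ifs <;> field_simp <;> ring

theorem normPieriCoeff_topBoxes {α : ℝ} (hα : 0 < α) {p : ℕ} (hp : p ≤ N) (η : Fin N → ℕ) :
    normPieriCoeff α p η (topBoxes p η) = ∏ i ∈ G1 p η, ∏ k ∈ G0 p η,
      (eigenvalue α η i - eigenvalue α η k + (if i < k then α else 0) - 1) /
        (eigenvalue α η i - eigenvalue α η k + if i < k then α else 0) := by
  have hprod : ∏ i, ∏ k ∈ univ.filter (Precedes (topBoxes p η) i),
      pairFactor α (topBoxes p η) i k =
      (∏ i, ∏ k ∈ univ.filter (Precedes η i), pairFactor α η i k) *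
        ∏ i ∈ G1 p η, ∏ k ∈ G0 p η, (pairArg α η i k - 1 / α) / pairArg α η i k := by
    have h₁ : ∀ i : Fin N, univ.filter (Precedes (topBoxes p η) i) =
        univ.filter (Precedes η i) := fun i => by
      ext k
      simp [precedes_topBoxes_iff]
    have h₂ : ∀ i : Fin N, (∏ k ∈ univ.filter (Precedes η i),
        if i ∈ G1 p η ∧ k ∈ G0 p η then (pairArg α η i k - 1 / α) / pairArg α η i k else 1) =
        if i ∈ G1 p η then ∏ k ∈ G0 p η, (pairArg α η i k - 1 / α) / pairArg α η i k
          else 1 := by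
      intro i
      by_cases hi : i ∈ G1 p η
      · simp only [hi, true_and, if_true]
        rw [← prod_filter, filter_filter]
        refine prod_congr ?_ fun _ _ => rfl
        ext k
        simp only [mem_filter, mem_univ, true_and]
        exact ⟨fun h => h.2, fun h => ⟨precedes_of_mem_G1_of_mem_G0 hi h, h⟩⟩
      · simp [hi]
    simp only [h₁]
    rw [prod_congr rfl fun i _ => prod_congr rfl fun k hk =>
      pairFactor_topBoxes hα p (mem_filter.1 hk).2]
    simp only [prod_mul_distrib, h₂]
    rw [prod_ite_mem, univ_inter]
  have hQ : (∏ i, ∏ k ∈ univ.filter (Precedes η i), pairFactor α η i k) ≠ 0 :=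
    prod_ne_zero_iff.2 fun i _ => prod_ne_zero_iff.2 fun k hk =>
      ((mem_filter.1 hk).2.pairFactor_pos hα).ne'
  have hC : (∏ j : Fin N, Real.Gamma (1 + ((N : ℝ) - 1) / α - (j : ℝ) / α)) ≠ 0 :=
    prod_ne_zero_iff.2 fun j _ => by simpa using (Gamma_base_pos hα j 0).ne'
  have he₁ := (ePrime_pos hα η).ne'
  have he₂ := (ePrime_pos hα (topBoxes p η)).ne'
  rw [normPieriCoeff, pieriCoeff_topBoxes hα hp, dPrime_eq hα, dPrime_eq hα η, hprod, mul_one]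
  simp only [pairArg_sub_div hα]
  set C := ∏ j : Fin N, Real.Gamma (1 + ((N : ℝ) - 1) / α - (j : ℝ) / α)
  set Q := ∏ i, ∏ k ∈ univ.filter (Precedes η i), pairFactor α η i k
  set R := ∏ i ∈ G1 p η, ∏ k ∈ G0 p η,
    (eigenvalue α η i - eigenvalue α η k + (if i < k then α else 0) - 1) /
        (eigenvalue α η i - eigenvalue α η k + if i < k then α else 0)
  clear_value C Q R
  field_simp

/-- Each pair is placed according to which row has the smaller index; when it is the row in `G0`,
numerator and denominator change sign. -/
theorem prod_G1_G0_eq {α : ℝ} (p : ℕ) (η : Fin N → ℕ) (ev : Fin N → ℝ) :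
    (∏ i ∈ G1 p η, ∏ k ∈ G0 p η, (ev i - ev k + (if i < k then α else 0) - 1) /
        (ev i - ev k + if i < k then α else 0)) =
      (∏ x ∈ (G0 p η ×ˢ G1 p η).filter (fun x => x.1 < x.2),
        (ev x.1 - ev x.2 + 1) / (ev x.1 - ev x.2)) *
      (∏ x ∈ (G1 p η ×ˢ G0 p η).filter (fun x => x.1 < x.2),
        (ev x.1 - ev x.2 + α - 1) / (ev x.1 - ev x.2 + α)) := by
  rw [prod_filter, prod_filter, prod_product_right, prod_product, ← prod_mul_distrib]
  refine prod_congr rfl fun i hi => ?_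
  rw [← prod_mul_distrib]
  refine prod_congr rfl fun k hk => ?_
  rcases lt_trichotomy i k with h | rfl | h
  · rw [if_pos h, if_neg h.not_gt, if_pos h, one_mul]
  · exact absurd hi (not_mem_G1_iff.2 hk)
  · rw [if_neg h.not_gt, if_pos h, if_neg h.not_gt, mul_one, add_zero, ← neg_div_neg_eq]
    congr 1 <;> ring

end

end NSJack

theorem mainTheorem4 {N : ℕ} (p : ℕ) (hpN : p ≤ N) (α : ℝ) (hα : 0 < α) (η : Fin N → ℕ) :
    -- for every composition there is exactly one non-symmetric Jack polynomial
    (∀ (ν : Fin N → ℕ) (P : MvPolynomial (Fin N) ℝ),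
      NSJack.IsNonsymmJack α ν P ↔ P = NSJack.nonsymmJack α ν) ∧
    -- the expansion exists and its coefficients are unique
    (∀ A : (Fin N → ℕ) →₀ ℝ,
      NSJack.IsPieriExpansion α p η A ↔ A = NSJack.pieriCoeff α p η) ∧
    -- the set `M*` exists and is unique
    ∃ M : Finset (Fin N), (∀ M', NSJack.IsTopSet p η M' ↔ M' = M) ∧
      let ν : Fin N → ℕ := NSJack.addBoxes η M
      let π : Equiv.Perm (Fin N) := NSJack.rowPerm ν η
      let ev : Fin N → ℝ := NSJack.eigenvalue α η
      -- the coefficient of the maximal term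
      NSJack.pieriCoeff α p η ν = 1 ∧
      -- the rows to which a box is added
      (∀ i, ν i = if NSJack.colegLength η i < p then η i + 1 else η i) ∧
      -- the alternative description of the two sets of rows
      NSJack.G0 p η = Finset.univ.filter (fun j => ν (π j) = η j) ∧
      NSJack.G1 p η = Finset.univ.filter (fun j => ν (π j) = η j + 1) ∧
      -- no quotient below has a vanishing denominator
      NSJack.ePrime α ν ≠ 0 ∧ NSJack.dPrime α η ≠ 0 ∧
      (∀ j ∈ NSJack.G0 p η, ∀ k ∈ NSJack.G1 p η, ev j - ev k ≠ 0) ∧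
      (∀ j ∈ NSJack.G1 p η, ∀ k ∈ NSJack.G0 p η, ev j - ev k + α ≠ 0) ∧
      -- the product formula for the normalized coefficient
      NSJack.normPieriCoeff α p η ν =
        (∏ x ∈ (NSJack.G0 p η ×ˢ NSJack.G1 p η).filter (fun x => x.1 < x.2),
          (ev x.1 - ev x.2 + 1) / (ev x.1 - ev x.2)) *
        (∏ x ∈ (NSJack.G1 p η ×ˢ NSJack.G0 p η).filter (fun x => π x.1 < π x.2),
          (ev x.1 - ev x.2 + α - 1) / (ev x.1 - ev x.2 + α)) := by

  refine ⟨fun ν P => NSJack.isNonsymmJack_iff_eq hα ν P,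
    fun A => NSJack.isPieriExpansion_iff hα p η A, NSJack.G1 p η, NSJack.isTopSet_iff hpN η, ?_⟩
  intro ν π ev
  have hν : ∀ i, ν i = if NSJack.colegLength η i < p then η i + 1 else η i :=
    NSJack.topBoxes_apply p η
  have hπ : π = 1 := NSJack.rowPerm_topBoxes p η
  have hev : ∀ j ∈ NSJack.G1 p η, ∀ k ∈ NSJack.G0 p η, ev k < ev j := fun j hj k hk =>
    (NSJack.precedes_of_mem_G1_of_mem_G0 hj hk).eigenvalue_lt hα
  refine ⟨NSJack.pieriCoeff_topBoxes hα hpN η, hν, ?_, ?_, (NSJack.ePrime_pos hα ν).ne',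
    (NSJack.dPrime_pos hα η).ne', fun j hj k hk => (sub_neg.2 (hev k hk j hj)).ne,
    fun j hj k hk => (add_pos (sub_pos.2 (hev j hj k hk)) hα).ne', ?_⟩
  · ext j
    rw [Finset.mem_filter, hπ, Equiv.Perm.one_apply, hν, NSJack.mem_G0]
    split_ifs with h <;> simp <;> omega
  · ext j
    rw [Finset.mem_filter, hπ, Equiv.Perm.one_apply, hν, NSJack.mem_G1]
    split_ifs with h <;> simp <;> omega
  -- With `π = 1` the condition `π j < π k` is `j < k`, the form in which the pairs were split.
  · rw [hπ]
    exact (NSJack.normPieriCoeff_topBoxes hα hpN η).trans (NSJack.prod_G1_G0_eq p η ev)
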